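/- **Notation.** A weak composition $\alpha=(\alpha_1,\alpha_2,\dots)$ of $n$ (written $\alpha\models n$) is a sequence of nonnegative integers with finitely many nonzero terms and sum $n$; a partition $\lambda\vdash n$ is a weakly decreasing weak composition, identified with its Young diagram (row $i$ has $\lambda_i$ boxes). Put $$\mathsf n(\lambda):=\sum_{i\ge1}\binom{\lambda_i}{2},\qquad [m]_q:=1+q+\dots+q^{m-1},\qquad [m]_q!:=[m]_q[m-1]_q\cdots[1]_q,\qquad \binom{m}{k}_q:=\frac{[m]_q!}{[k]_q!\,[m-k]_q!}.$$ $\mathrm{SSYT}(\lambda)$ is the set of semistandard Young tableaux of shape $\lambda$ with positive integer entries (rows weakly increasing, columns strictly increasing), and $\mathrm{SSYT}(\lambda,\alpha)$ is the subset of those of content $\alpha$, i.e. containing exactly $\alpha_i$ entries $i$ for every $i\ge1$. For a semistandard tableau $T$, let $T^{(j)}$ be the partition formed by the boxes with entries $1,\dots,j$, and put $$\mathrm{wt}_q(T):=\prod_{i,j\ge1}\binom{T^{(j)}_i-T^{(j)}_{i+1}}{T^{(j)}_i-T^{(j-1)}_i}_q,\qquad W_\lambda(\mathbf x;q):=\sum_{T\in\mathrm{SSYT}(\lambda)}\mathrm{wt}_q(T)\prod_{i\ge1}x_i^{\#\{i\text{'s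 in }T\}}.$$ For a nilpotent endomorphism $N$ of a finite-dimensional vector space, $\mathrm{JF}(N)$ denotes the conjugate of the partition formed by the sizes of the Jordan blocks of $N$. Let $\Bbbk$ be a finite field and $q:=1/|\Bbbk|$. For $\alpha\models n$, the $i$th block of $\alpha$ is the interval $\{\alpha_1+\dots+\alpha_{i-1}+1,\dots,\alpha_1+\dots+\alpha_i\}$, and $\mathfrak n_\alpha$ is the space of $n\times n$ matrices over $\Bbbk$ all of whose entries with row in the $i$th block and column in the $j$th block, $j\le i$, are zero (strictly block-upper-triangular matrices). Let $E^{\mathrm{id}}=(E^{\mathrm{id}}_i)_{i\ge0}$ be the standard partial flag, where $E^{\mathrm{id}}_i\subseteq\Bbbk^n$ is spanned by the first $\alpha_1+\dots+\alpha_i$ unit vectors. Every $N\in\mathfrak n_\alpha$ satisfies $N(E^{\mathrm{id}}_i)\subseteq E^{\mathrm{id}}_{i-1}$ for all $i\ge1$, and $\mathrm{JF}(N;E^{\mathrm{id}})$ denotes the semistandard tableau $T$ of shape $\mathrm{JF}(N)$ and content $\alpha$ such that $T^{(i)}=\mathrm{JF}\big(N|_{E^{\mathrm{id}}_i}\big)$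 for all $i$. **Theorem 4.10.** Let $\Bbbk$ be a finite field, $q:=1/|\Bbbk|$, $n\ge0$, $\lambda\vdash n$ and $\alpha\models n$. (i) For every $T\in\mathrm{SSYT}(\lambda,\alpha)$, $$\mathrm{wt}_q(T)=\frac{q^{\binom n2-\mathsf n(\lambda)}\,(1-q)^{-n+\lambda_1}\prod_{i\ge1}[\lambda_i-\lambda_{i+1}]_q!}{\prod_{i\ge1}[\alpha_i]_q!}\;\#\{N\in\mathfrak n_\alpha:\mathrm{JF}(N;E^{\mathrm{id}})=T\}.$$ (ii) The coefficient of $\mathbf x^\alpha=\prod_{i\ge1}x_i^{\alpha_i}$ in $W_\lambda(\mathbf x;q)$ is $$[\mathbf x^\alpha]W_\lambda(\mathbf x;q)=\frac{q^{\binom n2-\mathsf n(\lambda)}\,(1-q)^{-n+\lambda_1}\prod_{i\ge1}[\lambda_i-\lambda_{i+1}]_q!}{\prod_{i\ge1}[\alpha_i]_q!}\;\#\{N\in\mathfrak n_\alpha:\mathrm{JF}(N)=\lambda\}.$$ -/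

import Mathlib

namespace QWhittaker

/-! ### Conventions

A weak composition `α = (α₁, α₂, …)`, taken modulo trailing zeros, is a finitely supported function
`α : ℕ →₀ ℕ`, where `α i` stands for `α_{i+1}`; its size is `α.degree`.  A partition is a
`YoungDiagram`, with `lam.rowLen i` standing for `λ_{i+1}`.  In the same way the letter `i : ℕ` of a
semistandard tableau and the variable of index `i : ℕ` stand for the letter `i + 1` and for
`x_{i+1}`. -/

/-! ### `q`-analogues -/

section QAnalogues

variable {F : Type*} [Field F]

/-- The `q`-number `[n]_q = 1 + q + ⋯ + q^(n-1)`. -/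
def qNumber (q : F) (n : ℕ) : F := ∑ i ∈ Finset.range n, q ^ i

/-- The `q`-factorial `[n]_q! = [n]_q [n-1]_q ⋯ [1]_q`. -/
def qFactorial (q : F) (n : ℕ) : F := ∏ i ∈ Finset.range n, qNumber q (i + 1)

/-- The `q`-binomial coefficient `[n]_q! / ([k]_q! [n-k]_q!)`, for `0 ≤ k ≤ n` and `q` not a root of
unity other than `1`, so that the denominator does not vanish (below, `0 < q < 1`). -/
def qBinomial (q : F) (n k : ℕ) : F :=
  qFactorial q n / (qFactorial q k * qFactorial q (n - k))

end QAnalogues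

/-- The sum of `binom(λ_i, 2)` over the rows of a partition. -/
def nCon (lam : YoungDiagram) : ℕ := ∑ i ∈ Finset.range (lam.colLen 0), (lam.rowLen i).choose 2

/-! ### Semistandard tableaux and `q`-Whittaker functions -/

section Tableaux

variable {lam : YoungDiagram}

/-- The content of a tableau: the value at a letter is the number of boxes containing it. -/
noncomputable def content (T : SemistandardYoungTableau lam) : ℕ →₀ ℕ :=
  ∑ c ∈ lam.cells, Finsupp.single (T c.1 c.2) 1

/-- The partition `T^(j)` formed by the boxes of `T` that contain one of the first `j` letters
(that is, one of the numbers `0, …, j - 1` in the present numbering of the letters). -/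
def subShape (T : SemistandardYoungTableau lam) (j : ℕ) : YoungDiagram where
  cells := lam.cells.filter fun c => T c.1 c.2 < j
  isLowerSet := by
    rintro ⟨a, b⟩ ⟨c, d⟩ hle h
    obtain ⟨hca, hdb⟩ := Prod.mk_le_mk.mp hle
    simp only [Finset.coe_filter, YoungDiagram.mem_cells, Set.mem_ofPred_eq] at h ⊢
    obtain ⟨hab, hlt⟩ := h
    have hcb : (a, d) ∈ lam := lam.up_left_mem le_rfl hdb hab
    exact ⟨lam.up_left_mem hca hdb hab,
      ((T.col_weak hca hcb).trans (T.row_weak_of_le hdb hab)).trans_lt hlt⟩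

variable {F : Type*} [Field F]

/-- The `q`-weight of a semistandard tableau: the product over all rows `i` and all letters `j` of
the `q`-binomial coefficients
`[T^(j)_i - T^(j)_{i+1} choose T^(j)_i - T^(j-1)_i]_q`.
All but finitely many factors are `1`, and no subtraction truncates because `T^(j) / T^(j-1)` is a
horizontal strip. -/
noncomputable def qWeight (q : F) (T : SemistandardYoungTableau lam) : F :=
  ∏ᶠ p : ℕ × ℕ,
    qBinomial q
      ((subShape T (p.2 + 1)).rowLen p.1 - (subShape T (p.2 + 1)).rowLen (p.1 + 1))
      ((subShape T (p.2 + 1)).rowLen p.1 - (subShape T p.2).rowLen p.1)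

/-- The `q`-Whittaker function: the formal power series which is the sum of `wt_q(T) x^T` over all
semistandard tableaux `T` of shape `lam`, the sum of this family of power series being taken
coefficient by coefficient (for each monomial only finitely many `T` contribute). -/
noncomputable def whittaker (q : F) (lam : YoungDiagram) : MvPowerSeries ℕ F :=
  fun m => ∑ᶠ T : SemistandardYoungTableau lam,
    MvPowerSeries.coeff m (MvPowerSeries.monomial (content T) (qWeight q T))

end Tableaux

/-! ### Jordan forms of nilpotent endomorphisms -/

section Jordan

variable (K : Type*) [Field K]

/-- The nilpotent Jordan block of size `m`, with ones just above the diagonal. -/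
def jordanBlock (m : ℕ) : Matrix (Fin m) (Fin m) K :=
  Matrix.of fun a b => if (a : ℕ) + 1 = (b : ℕ) then 1 else 0

/-- The block-diagonal matrix whose diagonal blocks are nilpotent Jordan blocks, one for each row
of `mu`, of the size of that row. -/
def jordanMatrix (mu : YoungDiagram) :
    Matrix (Σ i : Fin (mu.colLen 0), Fin (mu.rowLen i))
      (Σ i : Fin (mu.colLen 0), Fin (mu.rowLen i)) K :=
  Matrix.blockDiagonal' fun i => jordanBlock K (mu.rowLen i)

variable {K}
variable {V : Type*} [AddCommGroup V] [Module K V]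

/-- `JF(f) = lam`: the conjugated Jordan form partition of the nilpotent endomorphism `f` is `lam`,
that is, with respect to some basis `f` is represented by the Jordan matrix of the conjugate of
`lam`.  (Such an `f` is automatically nilpotent, and `lam` is unique.) -/
def HasJF (f : V →ₗ[K] V) (lam : YoungDiagram) : Prop :=
  ∃ b : Module.Basis
      (Σ i : Fin (lam.transpose.colLen 0), Fin (lam.transpose.rowLen i)) K V,
    LinearMap.toMatrix b b f = jordanMatrix K lam.transpose

end Jordan

/-! ### Partial flags and strict compatibility -/

/-- `α_1 + ⋯ + α_i`. -/
def partialSum (α : ℕ →₀ ℕ) (i : ℕ) : ℕ := ∑ j ∈ Finset.range i, α j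

section Flags

variable (K : Type*) [Field K] {n : ℕ}

/-- Partial flags in `K^n` of type `α`: increasing sequences of subspaces `F_0 ⊆ F_1 ⊆ ⋯` with
`dim F_i = α_1 + ⋯ + α_i`.  As `α` is taken modulo trailing zeros, the index runs over all of `ℕ`;
when `α` has size `n` the sequence is constantly `K^n` from the last nonzero part on. -/
structure PartialFlag (n : ℕ) (α : ℕ →₀ ℕ) where
  /-- The subspaces of the flag. -/
  space : ℕ → Submodule K (Fin n → K)
  mono : Monotone space
  finrank_eq : ∀ i, Module.finrank K (space i) = partialSum α i

theorem partialSum_mono (α : ℕ →₀ ℕ) : Monotone (partialSum α) := fun _ _ h =>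
  Finset.sum_le_sum_of_subset (Finset.range_subset_range.mpr h)

theorem partialSum_le_degree (α : ℕ →₀ ℕ) (i : ℕ) : partialSum α i ≤ α.degree := by
  rw [Finsupp.degree_apply, partialSum]
  exact Finset.sum_le_sum_of_ne_zero fun x _ hx => Finsupp.mem_support_iff.mpr hx

/-- The standard flag `E^id` of type `α`: its `i`-th space is the span of the first
`α_1 + ⋯ + α_i` unit vectors. -/
def standardFlag (α : ℕ →₀ ℕ) (hα : α.degree = n) : PartialFlag K n α where
  space i := Submodule.span K
    ((fun j : Fin n => (Pi.single j 1 : Fin n → K)) '' {j | (j : ℕ) < partialSum α i})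
  mono i i' h := Submodule.span_mono <| Set.image_mono fun j (hj : (j : ℕ) < _) =>
    hj.trans_le (partialSum_mono α h)
  finrank_eq i := by
    have hle : partialSum α i ≤ n := hα ▸ partialSum_le_degree α i
    have hli : LinearIndependent K (fun j : Fin n => (Pi.single j 1 : Fin n → K)) := by
      have h := (Pi.basisFun K (Fin n)).linearIndependent
      have e : ⇑(Pi.basisFun K (Fin n)) = fun j : Fin n => (Pi.single j 1 : Fin n → K) :=
        funext fun j => Pi.basisFun_apply K (Fin n) j
      rwa [e] at h
    rw [Set.image_eq_range]
    refine (finrank_span_eq_card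
      (hli.comp (fun x : {j : Fin n | (j : ℕ) < partialSum α i} => (x : Fin n))
        Subtype.val_injective)).trans ?_
    rw [Fintype.card_eq_nat_card]
    refine (Nat.card_congr (β := Fin (partialSum α i))
      { toFun := fun x => ⟨x.1, x.2⟩
        invFun := fun y => ⟨⟨y, y.2.trans_le hle⟩, y.2⟩
        left_inv := fun _ => rfl
        right_inv := fun _ => rfl }).trans ?_
    simp

variable {K} {α : ℕ →₀ ℕ}

/-- `F` and `N` are strictly compatible if `N(F_i) ⊆ F_{i-1}` for all `i ≥ 1`. -/
def StrictlyCompatible (F : PartialFlag K n α) (N : (Fin n → K) →ₗ[K] (Fin n → K)) : Prop :=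
  ∀ i, (F.space (i + 1)).map N ≤ F.space i

theorem StrictlyCompatible.mapsTo {F : PartialFlag K n α} {N : (Fin n → K) →ₗ[K] (Fin n → K)}
    (h : StrictlyCompatible F N) (i : ℕ) : ∀ x ∈ F.space i, N x ∈ F.space i := fun _ hx =>
  h i (Submodule.mem_map_of_mem (F.mono (Nat.le_succ i) hx))

/-- `JF(N; F) = T`: `F` and `N` are strictly compatible, and for all `i` the partition `T^(i)` is
the conjugated Jordan form partition of the restriction of `N` to `F_i`. -/
def HasTableauJF {lam : YoungDiagram} (N : (Fin n → K) →ₗ[K] (Fin n → K)) (F : PartialFlag K n α)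
    (T : SemistandardYoungTableau lam) : Prop :=
  ∃ h : StrictlyCompatible F N, ∀ i, HasJF (N.restrict (h.mapsTo i)) (subShape T i)

/-- The `i`-th block of `α`, as a set of row or column indices (rows and columns of matrices being
numbered from `0`). -/
def block (n : ℕ) (α : ℕ →₀ ℕ) (i : ℕ) : Set (Fin n) :=
  {r | partialSum α i ≤ (r : ℕ) ∧ (r : ℕ) < partialSum α (i + 1)}

/-- The space `𝔫_α` of block-strictly-upper-triangular matrices: every entry with row in block `i`
and column in block `j`, where `j ≤ i`, is zero. -/
def nilradical (K : Type*) [Field K] (n : ℕ) (α : ℕ →₀ ℕ) :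
    Submodule K (Matrix (Fin n) (Fin n) K) where
  carrier := {N | ∀ i j, j ≤ i → ∀ r ∈ block n α i, ∀ c ∈ block n α j, N r c = 0}
  add_mem' := by
    intro A B hA hB i j hij r hr c hc
    simp [hA i j hij r hr c hc, hB i j hij r hr c hc]
  zero_mem' := by
    intro i j hij r hr c hc
    rfl
  smul_mem' := by
    intro a A hA i j hij r hr c hc
    simp [hA i j hij r hr c hc]

end Flags

end QWhittaker

/-! The conjugated Jordan type `μ` of a nilpotent `f` on `V` is visible in ranks: `rank f^k` is the
number of boxes of `μ` in rows of index at least `k`, or equivalently `μ_i = dim (f^i V ∩ ker f)`,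
rows being numbered from 0 (`hasJF_iff_finrank_range_pow`). Hence `JF(N; E) = T` is a system of rank
conditions on the spaces `N^i(E_m)`, and its solutions can be counted by building `N` one step of
the flag at a time.

To go from `E_k` to `E_{k+1}`, one chooses `a = α k` new columns `x_j` in `E_k`; then
`N^{i+1}(E_{k+1}) = N^i(N E_k + span x)`. Let the shape grow from `μ` to `ν`. Columns with
prescribed images under `N` differ by vectors of `E_k ∩ ker N`, and the number of lifts that satisfy
the one remaining rank condition is a power of `Q = |K|` times a number of matrices of given size
and rank (`natCard_translates`). Descending through `E_k, N E_k, N² E_k, …` yields for each `i` the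
number of `(μ_i - μ_{i+1}) × b_{i+1}` matrices of rank `ν_{i+1} - μ_{i+1}`, where `b_i` counts the
new boxes in rows `0, …, i` (`natCard_extensions`). The result depends only on `μ` and `ν`, so the
counts of the successive steps multiply.

With the closed formula for rank counts (`rankCount_mul_qFactorial`), the product over the rows
telescopes: up to `[a]_q!`, it is the `q`-binomial weight of the strip `ν/μ` times the ratio of the
prefactors of `μ` and `ν` (`prod_qBinomial_mul_shapeFactor`). The prefactors telescope along `T`,
which gives (i).

For (ii), (i) is summed over `T`: strict compatibility makes consecutive shapes differ by horizontal
strips, so every `N` in `𝔫_α` of type `λ` has exactly one tableau (`exists_hasTableauJF`,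
`hasTableauJF_unique`). -/

namespace QWhittaker

open Module

/-! ### Tail sums of row lengths of Young diagrams. -/

section YoungTail

/-- The number of boxes of a Young diagram in the rows of index at least `i`. -/
def tailCard (mu : YoungDiagram) (i : ℕ) : ℕ := (mu.cells.filter fun c => i ≤ c.1).card

theorem tailCard_zero (mu : YoungDiagram) : tailCard mu 0 = mu.card := by
  simp [tailCard]

theorem tailCard_eq_add (mu : YoungDiagram) (i : ℕ) :
    tailCard mu i = mu.rowLen i + tailCard mu (i + 1) := by
  rw [YoungDiagram.rowLen_eq_card, tailCard, tailCard, ← Finset.card_union_of_disjoint]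
  · congr 1
    ext c
    simp only [Finset.mem_filter, Finset.mem_union, YoungDiagram.mem_row_iff,
      YoungDiagram.mem_cells]
    constructor
    · rintro ⟨h, h'⟩
      rcases Nat.eq_or_lt_of_le h' with h'' | h''
      · exact Or.inl ⟨h, h''.symm⟩
      · exact Or.inr ⟨h, h''⟩
    · rintro (⟨h, h'⟩ | ⟨h, h'⟩)
      · exact ⟨h, h'.ge⟩
      · exact ⟨h, by omega⟩
  · rw [Finset.disjoint_left]
    intro c hc hc'
    have := (YoungDiagram.mem_row_iff.mp hc).2
    have := (Finset.mem_filter.mp hc').2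
    omega

theorem tailCard_eq_zero {mu : YoungDiagram} {i : ℕ} (hi : mu.colLen 0 ≤ i) :
    tailCard mu i = 0 := by
  rw [tailCard, Finset.card_eq_zero, Finset.filter_eq_empty_iff]
  rintro ⟨a, b⟩ hc hle
  have h1 : (a, 0) ∈ mu := mu.up_left_mem le_rfl (Nat.zero_le b) hc
  rw [YoungDiagram.mem_iff_lt_colLen] at h1
  simp only at hle
  omega

theorem rowLen_eq_zero {mu : YoungDiagram} {i : ℕ} (hi : mu.colLen 0 ≤ i) : mu.rowLen i = 0 := by
  have := tailCard_eq_add mu i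
  rw [tailCard_eq_zero hi] at this
  omega

theorem youngDiagram_ext {mu nu : YoungDiagram} (h : ∀ i, mu.rowLen i = nu.rowLen i) :
    mu = nu := by
  ext ⟨i, j⟩
  simp [YoungDiagram.mem_cells, YoungDiagram.mem_iff_lt_rowLen, h]

theorem tailCard_injective : Function.Injective tailCard := by
  intro mu nu h
  refine youngDiagram_ext fun i => ?_
  have h1 := tailCard_eq_add mu i
  have h2 := tailCard_eq_add nu i
  rw [h] at h1
  omega

/-- Jordan chains are the columns of `mu`. Sending position `j` of chain `c` to the box `(j + k, c)`
matches the positions that remain in the chain after a shift by `k` with the boxes in rows of index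
at least `k`. -/
theorem card_jordanIndex (mu : YoungDiagram) (k : ℕ) :
    ((Finset.univ : Finset (Σ i : Fin (mu.transpose.colLen 0),
      Fin (mu.transpose.rowLen i))).filter
        fun x => (x.2 : ℕ) + k < mu.transpose.rowLen x.1).card = tailCard mu k := by
  rw [tailCard]
  refine Finset.card_bij (fun x _ => ((x.2 : ℕ) + k, (x.1 : ℕ))) ?_ ?_ ?_
  · rintro ⟨c, j⟩ hx
    simp only [Finset.mem_filter, Finset.mem_univ, true_and, YoungDiagram.mem_cells] at hx ⊢
    exact ⟨YoungDiagram.mem_iff_lt_colLen.mpr (hx.trans_eq (mu.rowLen_transpose c)),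
      Nat.le_add_left _ _⟩
  · rintro ⟨c, j⟩ _ ⟨c', j'⟩ _ h
    simp only [Prod.mk.injEq] at h
    obtain rfl : c = c' := Fin.ext h.2
    obtain rfl : j = j' := Fin.ext (by omega)
    rfl
  · rintro ⟨i, c⟩ hx
    simp only [Finset.mem_filter, YoungDiagram.mem_cells] at hx
    obtain ⟨hx, hk⟩ := hx
    have hc : c < mu.transpose.colLen 0 := by
      rw [YoungDiagram.colLen_transpose]
      exact YoungDiagram.mem_iff_lt_rowLen.mp (mu.up_left_mem (Nat.zero_le i) le_rfl hx)
    have hi : i < mu.transpose.rowLen c := by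
      rw [YoungDiagram.rowLen_transpose]
      exact YoungDiagram.mem_iff_lt_colLen.mp hx
    refine ⟨⟨⟨c, hc⟩, ⟨i - k, by simp only; omega⟩⟩, ?_, ?_⟩
    · simp only [Finset.mem_filter, Finset.mem_univ, true_and]
      omega
    · simp only [Prod.mk.injEq, and_true]
      omega

end YoungTail

/-! ### Jordan forms and ranks of powers. -/

section JordanForm

variable {K : Type*} [Field K] {V : Type*} [AddCommGroup V] [Module K V]

theorem hasJF_iff_exists_basis (f : V →ₗ[K] V) (mu : YoungDiagram) :
    HasJF f mu ↔ ∃ b : Basis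
      (Σ i : Fin (mu.transpose.colLen 0), Fin (mu.transpose.rowLen i)) K V,
      ∀ c j, f (b ⟨c, j⟩) =
        if (j : ℕ) = 0 then 0 else b ⟨c, ⟨j - 1, (Nat.sub_le _ _).trans_lt j.2⟩⟩ := by
  unfold HasJF
  refine exists_congr fun b => ?_
  have key : ∀ c j, ∑ x, jordanMatrix K mu.transpose x ⟨c, j⟩ • b x =
      if (j : ℕ) = 0 then 0 else b ⟨c, ⟨j - 1, (Nat.sub_le _ _).trans_lt j.2⟩⟩ := by
    intro c j
    rw [Fintype.sum_sigma, Finset.sum_eq_single c]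
    · simp only [jordanMatrix, Matrix.blockDiagonal'_apply_eq, jordanBlock, Matrix.of_apply]
      split_ifs with h
      · exact Finset.sum_eq_zero fun x _ => by rw [if_neg (by omega), zero_smul]
      · rw [Finset.sum_eq_single ⟨j - 1, (Nat.sub_le _ _).trans_lt j.2⟩]
        · rw [if_pos (by simp only; omega), one_smul]
        · intro x _ hx
          rw [if_neg, zero_smul]
          intro hx'
          exact hx (Fin.ext (by simp only; omega))
        · simp
    · intro c' _ hc
      refine Finset.sum_eq_zero fun x _ => ?_
      rw [jordanMatrix, Matrix.blockDiagonal'_apply_ne _ _ _ hc, zero_smul]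
    · simp
  constructor
  · intro h c j
    rw [← key, ← h]
    simp only [LinearMap.toMatrix_apply]
    exact (b.sum_repr _).symm
  · intro h
    ext x ⟨c, j⟩
    rw [LinearMap.toMatrix_apply, h, ← key, b.repr_sum_self]

/-- `f^k` moves every Jordan chain down by `k` places, so its image is spanned by the basis vectors
at distance at least `k` from the top of their chain. -/
theorem HasJF.finrank_range_pow {f : V →ₗ[K] V} {mu : YoungDiagram} (h : HasJF f mu) (k : ℕ) :
    finrank K (LinearMap.range (f ^ k)) = tailCard mu k := by
  obtain ⟨b, hb⟩ := (hasJF_iff_exists_basis f mu).mp h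
  have hpow : ∀ k c j, (f ^ k) (b ⟨c, j⟩) =
      if (j : ℕ) < k then 0 else b ⟨c, ⟨j - k, (Nat.sub_le _ _).trans_lt j.2⟩⟩ := by
    intro k
    induction k with
    | zero => simp
    | succ k ih =>
      intro c j
      rw [pow_succ', Module.End.mul_apply, ih]
      by_cases h1 : (j : ℕ) < k
      · rw [if_pos h1, if_pos (by omega), map_zero]
      · rw [if_neg h1, hb]
        by_cases h2 : (j : ℕ) < k + 1
        · rw [if_pos (by simp only; omega), if_pos h2]
        · rw [if_neg (by simp only; omega), if_neg h2]
          rfl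
  have hrange : LinearMap.range (f ^ k) = Submodule.span K
      (b '' {x | (x.2 : ℕ) + k < mu.transpose.rowLen x.1}) := by
    rw [LinearMap.range_eq_map, ← b.span_eq, Submodule.map_span]
    apply le_antisymm
    · rw [Submodule.span_le]
      rintro _ ⟨_, ⟨⟨c, j⟩, rfl⟩, rfl⟩
      rw [SetLike.mem_coe, hpow]
      split_ifs with hj
      · exact Submodule.zero_mem _
      · refine Submodule.subset_span ⟨_, ?_, rfl⟩
        have := j.2
        simp only [Set.mem_ofPred_eq]
        omega
    · apply Submodule.span_mono
      rintro _ ⟨⟨c, j⟩, hj, rfl⟩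
      refine ⟨_, ⟨⟨c, ⟨j + k, hj⟩⟩, rfl⟩, ?_⟩
      rw [hpow, if_neg (by simp)]
      simp
  rw [hrange, Set.image_eq_range]
  refine (finrank_span_eq_card (b.linearIndependent.comp
    (fun x : {x : Σ i : Fin (mu.transpose.colLen 0), Fin (mu.transpose.rowLen i) |
      (x.2 : ℕ) + k < mu.transpose.rowLen x.1} => x.1) Subtype.val_injective)).trans ?_
  rw [← card_jordanIndex, Fintype.card_subtype]
  rfl

/-- Chains are independent as soon as their ends `v c` in the kernel are. Applying `f^J` to a
relation kills the positions below `J` and moves position `J` to the ends; the positions above `J`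
already have coefficient zero by descending induction. -/
theorem linearIndependent_jordanChains {m : ℕ} {h : Fin m → ℕ} {f : V →ₗ[K] V} {u v : Fin m → V}
    (hli : LinearIndependent K v) (hker : ∀ c, f (v c) = 0)
    (huv : ∀ c, (f ^ (h c - 1)) (u c) = v c) :
    LinearIndependent K fun x : Σ c, Fin (h c) => (f ^ (h x.1 - 1 - x.2)) (u x.1) := by
  rw [Fintype.linearIndependent_iff]
  intro g hg
  have hpow : ∀ J c (j : Fin (h c)), (j : ℕ) < J →
      (f ^ J) ((f ^ (h c - 1 - j)) (u c)) = 0 := by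
    intro J c j hj
    rw [← Module.End.mul_apply, ← pow_add,
      show J + (h c - 1 - j) = (J - j - 1) + (1 + (h c - 1)) by omega, pow_add, pow_add, pow_one,
      Module.End.mul_apply, Module.End.mul_apply, huv, hker, map_zero]
  have main : ∀ k J, Finset.univ.sup h ≤ J + k → ∀ c (j : Fin (h c)), J ≤ j → g ⟨c, j⟩ = 0 := by
    intro k
    induction k with
    | zero =>
      intro J hJ c j hj
      have := Finset.le_sup (f := h) (Finset.mem_univ c)
      omega
    | succ k ih =>
      intro J hJ
      have ih' := ih (J + 1) (by omega)
      have h0 := congrArg (f ^ J) hg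
      rw [map_sum, map_zero, Fintype.sum_sigma] at h0
      have h1 : ∀ c, ∑ j : Fin (h c),
          (f ^ J) (g ⟨c, j⟩ • (f ^ (h c - 1 - j)) (u c)) =
          (if hJ : J < h c then g ⟨c, ⟨J, hJ⟩⟩ else 0) • v c := by
        intro c
        split_ifs with hJc
        · rw [Finset.sum_eq_single ⟨J, hJc⟩]
          · rw [map_smul, ← Module.End.mul_apply, ← pow_add,
              show J + (h c - 1 - J) = h c - 1 by omega, huv]
          · intro j _ hj
            rcases lt_trichotomy (j : ℕ) J with h' | h' | h'
            · rw [map_smul, hpow J c j h', smul_zero]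
            · exact absurd (Fin.ext h') hj
            · rw [ih' c j h', zero_smul, map_zero]
          · simp
        · rw [zero_smul]
          refine Finset.sum_eq_zero fun j _ => ?_
          rw [map_smul, hpow J c j (by omega), smul_zero]
      rw [Finset.sum_congr rfl fun c _ => h1 c] at h0
      have h2 := Fintype.linearIndependent_iff.mp hli _ h0
      intro c j hj
      rcases Nat.eq_or_lt_of_le hj with h' | h'
      · have h3 := h2 c
        rw [dif_pos (h' ▸ j.2)] at h3
        rw [← h3]
        congr 2
        exact Fin.ext h'.symm
      · exact ih' c j h'
  rintro ⟨c, j⟩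
  exact main (Finset.univ.sup h) 0 (by omega) c j (Nat.zero_le _)

theorem exists_linearIndepOn_extend [FiniteDimensional K V] (D : Submodule K V) (v : ℕ → V)
    {a : ℕ} (hv : LinearIndepOn K v (Set.Iio a)) (hD : ∀ c < a, v c ∈ D) {m : ℕ} (ham : a ≤ m)
    (hm : m ≤ finrank K D) :
    ∃ w : ℕ → V, LinearIndepOn K w (Set.Iio m) ∧ (∀ c < m, w c ∈ D) ∧ ∀ c < a, w c = v c := by
  induction m, ham using Nat.le_induction with
  | base => exact ⟨v, hv, hD, fun _ _ => rfl⟩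
  | succ m ham ih =>
    obtain ⟨w, hw, hwD, hwv⟩ := ih (by omega)
    obtain ⟨x, hxD, hx⟩ : ∃ x ∈ D, x ∉ Submodule.span K (w '' Set.Iio m) := by
      by_contra! hcon
      have h1 : finrank K D ≤ finrank K (Submodule.span K (w '' Set.Iio m)) :=
        Submodule.finrank_mono hcon
      have h2 : finrank K (Submodule.span K (w '' Set.Iio m)) ≤ m := by
        rw [Set.image_eq_range]
        have h3 := finrank_range_le_card (R := K) fun c : Set.Iio m => w c
        rwa [Fintype.card_eq_nat_card, Nat.card_coe_set_eq, Set.ncard_Iio_nat] at h3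
      omega
    have heq : ∀ c < m, Function.update w m x c = w c := fun c hc =>
      Function.update_of_ne (by omega) _ _
    have himg : Function.update w m x '' Set.Iio m = w '' Set.Iio m :=
      Set.image_congr fun c hc => heq c hc
    refine ⟨Function.update w m x, ?_, ?_, ?_⟩
    · have : Set.Iio (m + 1) = insert m (Set.Iio m) := by
        ext c; simp only [Set.mem_Iio, Set.mem_insert_iff]; omega
      rw [this, linearIndepOn_insert (by simp), himg, Function.update_self]
      exact ⟨(linearIndepOn_congr fun c hc => heq c hc).mpr hw, hx⟩
    · intro c hc
      rcases Nat.lt_succ_iff_lt_or_eq.mp hc with h | rfl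
      · rw [heq c h]; exact hwD c h
      · rw [Function.update_self]; exact hxD
    · intro c hc
      rw [heq c (by omega), hwv c hc]

/-- One sequence serves all spaces of a decreasing filtration: its initial segments are bases of
them. It is obtained by extending from the smallest space outwards. -/
theorem exists_linearIndepOn_adapted [FiniteDimensional K V] {D : ℕ → Submodule K V}
    (hD : Antitone D) {L : ℕ} (hL : D L = ⊥) :
    ∃ v : ℕ → V, LinearIndepOn K v (Set.Iio (finrank K (D 0))) ∧
      ∀ i, ∀ c < finrank K (D i), v c ∈ D i := by
  induction L generalizing D with
  | zero =>
    have h0 : ∀ i, finrank K (D i) = 0 := fun i => by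
      rw [Submodule.finrank_eq_zero, eq_bot_iff, ← hL]
      exact hD (Nat.zero_le i)
    refine ⟨0, ?_, fun i c hc => ?_⟩
    · rw [h0]
      have : Set.Iio 0 = (∅ : Set ℕ) := by ext; simp
      rw [this]
      exact linearIndepOn_empty K _
    · rw [h0] at hc
      exact absurd hc (Nat.not_lt_zero c)
  | succ L ih =>
    obtain ⟨v, hv, hvD⟩ := ih (D := fun i => D (i + 1)) (fun i j hij => hD (by omega)) hL
    have h10 : D 1 ≤ D 0 := hD (Nat.zero_le 1)
    obtain ⟨w, hw, hwD, hwv⟩ := exists_linearIndepOn_extend (D 0) v hv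
      (fun c hc => h10 (hvD 0 c hc)) (Submodule.finrank_mono h10) le_rfl
    refine ⟨w, hw, fun i c hc => ?_⟩
    cases i with
    | zero => exact hwD c hc
    | succ i =>
      rw [hwv c (hc.trans_le (Submodule.finrank_mono (hD (by omega))))]
      exact hvD i c hc

theorem finrank_map_add_finrank_inf_ker [FiniteDimensional K V] (f : V →ₗ[K] V)
    (p : Submodule K V) :
    finrank K (p.map f) + finrank K (p ⊓ LinearMap.ker f : Submodule K V) = finrank K p := by
  have h := LinearMap.finrank_range_add_finrank_ker (f.domRestrict p)
  rw [LinearMap.range_domRestrict, LinearMap.ker_domRestrict] at h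
  rw [← h, ← Submodule.map_comap_subtype,
    (Submodule.equivMapOfInjective p.subtype p.injective_subtype _).finrank_eq.symm]

/-- A nilpotent endomorphism has a Jordan form, which is determined by the ranks of its powers. -/
theorem hasJF_iff_finrank_range_pow [FiniteDimensional K V] (f : V →ₗ[K] V) (mu : YoungDiagram) :
    HasJF f mu ↔ ∀ k, finrank K (LinearMap.range (f ^ k)) = tailCard mu k := by
  refine ⟨fun h => h.finrank_range_pow, fun h => ?_⟩
  -- The ends of the chains of length greater than `i` should form a basis of `D i`, whose dimension
  -- is the drop in rank from `f^i` to `f^(i+1)`.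
  let D : ℕ → Submodule K V := fun i => LinearMap.range (f ^ i) ⊓ LinearMap.ker f
  have hmap : ∀ i, (LinearMap.range (f ^ i)).map f = LinearMap.range (f ^ (i + 1)) := fun i => by
    rw [pow_succ', Module.End.mul_eq_comp, LinearMap.range_comp]
  have hfin : ∀ i, finrank K (D i) = mu.rowLen i := fun i => by
    have h1 := finrank_map_add_finrank_inf_ker f (LinearMap.range (f ^ i))
    rw [hmap, h, h, tailCard_eq_add mu i] at h1
    change _ + finrank K (D i) = _ at h1
    omega
  have hanti : Antitone D := by
    refine antitone_nat_of_succ_le fun i => inf_le_inf_right _ ?_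
    rw [pow_succ, Module.End.mul_eq_comp]
    exact LinearMap.range_comp_le_range _ _
  have hL : D (mu.colLen 0) = ⊥ := by
    rw [← Submodule.finrank_eq_zero (R := K), hfin, rowLen_eq_zero le_rfl]
  obtain ⟨v, hv, hvD⟩ := exists_linearIndepOn_adapted hanti hL
  have hlt : ∀ c : Fin (mu.transpose.colLen 0), (c : ℕ) < mu.rowLen 0 := fun c =>
    c.2.trans_eq (YoungDiagram.colLen_transpose mu 0)
  have hpos : ∀ c : Fin (mu.transpose.colLen 0), 0 < mu.transpose.rowLen c := fun c => by
    rw [YoungDiagram.rowLen_transpose, ← YoungDiagram.mem_iff_lt_colLen,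
      YoungDiagram.mem_iff_lt_rowLen]
    exact hlt c
  -- The bottom box of column `c` lies in row `rowLen c - 1` of that column's count, so `c` is less
  -- than the dimension of this `D`. Thus `v c` is the end of a chain as long as column `c`.
  have hmem : ∀ c : Fin (mu.transpose.colLen 0), v c ∈ D (mu.transpose.rowLen c - 1) := fun c => by
    apply hvD
    rw [hfin, ← YoungDiagram.mem_iff_lt_rowLen, YoungDiagram.mem_iff_lt_colLen]
    have := hpos c
    have := mu.rowLen_transpose c
    omega
  choose u hu using fun c => (hmem c).1
  have hli : LinearIndependent K fun c : Fin (mu.transpose.colLen 0) => v c := by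
    rw [hfin] at hv
    exact hv.comp (fun c : Fin (mu.transpose.colLen 0) => (⟨c, hlt c⟩ : Set.Iio (mu.rowLen 0)))
      fun c c' hcc => Fin.ext (congrArg Subtype.val hcc)
  have hker : ∀ c : Fin (mu.transpose.colLen 0), f (v c) = 0 := fun c => (hmem c).2
  have hchain := linearIndependent_jordanChains hli hker hu
  have hcard : Fintype.card (Σ i : Fin (mu.transpose.colLen 0), Fin (mu.transpose.rowLen i)) =
      finrank K V := by
    have h0 := h 0
    rw [pow_zero, Module.End.one_eq_id, LinearMap.range_id, finrank_top, ← card_jordanIndex] at h0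
    rw [h0, Finset.filter_true_of_mem fun x _ => by have := x.2.2; omega]
    rfl
  rw [hasJF_iff_exists_basis]
  refine ⟨basisOfLinearIndependentOfCardEqFinrank' _ hchain hcard, fun c j => ?_⟩
  simp only [coe_basisOfLinearIndependentOfCardEqFinrank']
  rw [← Module.End.mul_apply, ← pow_succ']
  have hj := j.2
  split_ifs with h0
  · rw [show mu.transpose.rowLen c - 1 - j + 1 = 1 + (mu.transpose.rowLen c - 1) by omega, pow_add,
      Module.End.mul_apply, hu, pow_one, hker]
  · rw [show mu.transpose.rowLen c - 1 - j + 1 = mu.transpose.rowLen c - 1 - (j - 1) by omega]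

theorem range_restrict_pow (f : V →ₗ[K] V) (p : Submodule K V) (h : ∀ x ∈ p, f x ∈ p) (k : ℕ) :
    (LinearMap.range ((f.restrict h) ^ k)).map p.subtype = p.map (f ^ k) := by
  have hk : ∀ x : p, (((f.restrict h) ^ k) x : V) = (f ^ k) x := by
    intro x
    induction k with
    | zero => rfl
    | succ k ih =>
      rw [pow_succ', pow_succ', Module.End.mul_apply, Module.End.mul_apply,
        LinearMap.coe_restrict_apply, ih]
  ext y
  simp only [Submodule.mem_map, LinearMap.mem_range, Submodule.subtype_apply]
  constructor
  · rintro ⟨_, ⟨x, rfl⟩, rfl⟩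
    exact ⟨x, x.2, (hk x).symm⟩
  · rintro ⟨x, hx, rfl⟩
    exact ⟨_, ⟨⟨x, hx⟩, rfl⟩, hk ⟨x, hx⟩⟩

theorem hasJF_restrict_iff [FiniteDimensional K V] (f : V →ₗ[K] V) (p : Submodule K V)
    (h : ∀ x ∈ p, f x ∈ p) (mu : YoungDiagram) :
    HasJF (f.restrict h) mu ↔ ∀ k, finrank K (p.map (f ^ k)) = tailCard mu k := by
  rw [hasJF_iff_finrank_range_pow]
  refine forall_congr' fun k => ?_
  rw [← range_restrict_pow f p h, Submodule.finrank_map_subtype_eq]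

end JordanForm

end QWhittaker

namespace QWhittaker

open Module

/-! ### Counting by fibres. -/

section Cardinality

/-- This is the shape of a column-by-column rank recursion: `A` will say that the earlier vectors
already have the target rank, `B` that they fall short by one. -/
theorem natCard_subtype_prod_of_fibers {X Y : Type*} [Finite X] [Finite Y] {P : Y → X → Prop}
    {A B : X → Prop} {a b : ℕ} (hdisj : ∀ x, A x → ¬ B x)
    (hA : ∀ x, A x → Nat.card {y // P y x} = a) (hB : ∀ x, B x → Nat.card {y // P y x} = b)
    (hP : ∀ x y, P y x → A x ∨ B x) :
    Nat.card {p : Y × X // P p.1 p.2} = a * Nat.card {x // A x} + b * Nat.card {x // B x} := by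
  classical
  have := Fintype.ofFinite X
  have := Fintype.ofFinite Y
  have e : {p : Y × X // P p.1 p.2} ≃ Σ x, {y // P y x} :=
    { toFun := fun p => ⟨p.1.2, p.1.1, p.2⟩
      invFun := fun s => ⟨(s.2.1, s.1), s.2.2⟩
      left_inv := fun _ => rfl
      right_inv := fun _ => rfl }
  rw [Nat.card_congr e, Nat.card_sigma]
  have h : ∀ x, Nat.card {y // P y x} = (if A x then a else 0) + (if B x then b else 0) := by
    intro x
    by_cases h1 : A x
    · rw [if_pos h1, if_neg (hdisj x h1), hA x h1, add_zero]
    · by_cases h2 : B x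
      · rw [if_neg h1, if_pos h2, hB x h2, zero_add]
      · rw [if_neg h1, if_neg h2, Nat.card_eq_zero]
        exact Or.inl ⟨fun y => (hP x y.1 y.2).elim h1 h2⟩
  simp_rw [h, Finset.sum_add_distrib, Nat.card_eq_fintype_card, Fintype.card_subtype]
  rw [← Finset.sum_filter, ← Finset.sum_filter, Finset.sum_const, Finset.sum_const, smul_eq_mul,
    smul_eq_mul, mul_comm a, mul_comm b]

theorem natCard_subtype_of_fibers {X Y : Type*} [Finite X] [Finite Y] (p : X → Y) {P : X → Prop}
    {B : Y → Prop} {c : ℕ} (hPB : ∀ x, P x → B (p x))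
    (h : ∀ y, B y → Nat.card {x // p x = y ∧ P x} = c) :
    Nat.card {x // P x} = c * Nat.card {y // B y} := by
  have := Fintype.ofFinite {y // B y}
  have e : {x // P x} ≃ Σ y : {y // B y}, {x // p x = y.1 ∧ P x} :=
    { toFun := fun x => ⟨⟨p x.1, hPB x.1 x.2⟩, x.1, rfl, x.2⟩
      invFun := fun s => ⟨s.2.1, s.2.2.2⟩
      left_inv := fun _ => rfl
      right_inv := by
        rintro ⟨⟨y, hy⟩, ⟨x, hx⟩⟩
        obtain rfl : p x = y := hx.1
        rfl }
  rw [Nat.card_congr e, Nat.card_sigma, Finset.sum_congr rfl fun y _ => h y.1 y.2,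
    Finset.sum_const, smul_eq_mul, Finset.card_univ, Nat.card_eq_fintype_card, mul_comm]

end Cardinality

/-- The number of `d × b` matrices of rank `s` over a field with `Q` elements, computed column by
column. -/
def rankCount (Q d : ℕ) : ℕ → ℕ → ℕ
  | 0, 0 => 1
  | 0, _ + 1 => 0
  | b + 1, 0 => rankCount Q d b 0
  | b + 1, s + 1 => Q ^ (s + 1) * rankCount Q d b (s + 1) + (Q ^ d - Q ^ s) * rankCount Q d b s

/-! ### Counting extensions of an endomorphism to the next space of a flag. -/

section Counting

variable {K : Type*} [Field K] [Finite K] {V : Type*} [AddCommGroup V] [Module K V]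
  [FiniteDimensional K V]

omit [Finite K] in
-- The solutions form a coset of `D ⊓ U`, nonempty because `v ∈ U ⊔ D`.
theorem natCard_translate_mem (D U : Submodule K V) {v : V} (hv : v ∈ U ⊔ D) :
    Nat.card {y : D // v + y ∈ U} = Nat.card K ^ finrank K (D ⊓ U : Submodule K V) := by
  rw [← Module.natCard_eq_pow_finrank]
  obtain ⟨u, hu, d, hd, rfl⟩ := Submodule.mem_sup.mp hv
  refine Nat.card_congr
    { toFun := fun y => ⟨d + y.1, D.add_mem hd y.1.2, ?_⟩
      invFun := fun z => ⟨⟨z.1 - d, D.sub_mem z.2.1 hd⟩, ?_⟩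
      left_inv := fun y => Subtype.ext (Subtype.ext (by simp))
      right_inv := fun z => Subtype.ext (by simp) }
  · have h := U.sub_mem y.2 hu
    rwa [show u + d + (y.1 : V) - u = d + y.1 by abel] at h
  · rw [show u + d + (z.1 - d) = u + z.1 by abel]
    exact U.add_mem hu z.2.2

omit [Finite K] [FiniteDimensional K V] in
theorem sup_span_range_add_sup {a : ℕ} (W D : Submodule K V) (x : Fin a → V) (h : Fin a → D) :
    W ⊔ Submodule.span K (Set.range fun j => x j + h j) ⊔ D =
      W ⊔ D ⊔ Submodule.span K (Set.range x) := by
  apply le_antisymm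
  · refine sup_le (sup_le (le_sup_left.trans le_sup_left) ?_) (le_sup_right.trans le_sup_left)
    rw [Submodule.span_le]
    rintro _ ⟨j, rfl⟩
    exact Submodule.add_mem _ (Submodule.mem_sup_right (Submodule.subset_span ⟨j, rfl⟩))
      (Submodule.mem_sup_left (Submodule.mem_sup_right (h j).2))
  · refine sup_le (sup_le (le_sup_left.trans le_sup_left) le_sup_right) ?_
    rw [Submodule.span_le]
    rintro _ ⟨j, rfl⟩
    have h1 : x j + h j ∈ W ⊔ Submodule.span K (Set.range fun j => x j + h j) ⊔ D :=
      Submodule.mem_sup_left (Submodule.mem_sup_right (Submodule.subset_span ⟨j, rfl⟩))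
    have h2 : (h j : V) ∈ W ⊔ Submodule.span K (Set.range fun j => x j + h j) ⊔ D :=
      Submodule.mem_sup_right (h j).2
    simpa using Submodule.sub_mem _ h1 h2

omit [Finite K] [FiniteDimensional K V] in
theorem sup_span_range_cons {a : ℕ} (W : Submodule K V) (x : Fin (a + 1) → V) :
    W ⊔ Submodule.span K (Set.range x) =
      W ⊔ Submodule.span K (Set.range (Fin.tail x)) ⊔ Submodule.span K {x 0} := by
  conv_lhs => rw [← Fin.cons_self_tail x, Fin.range_cons, Set.insert_eq, Submodule.span_union]
  rw [sup_assoc, sup_comm (Submodule.span K {x 0})]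

/-- Given vectors `x_1, …, x_a`, the number of ways to translate them by vectors of `D` so that
together with `W` they span a space of prescribed dimension. -/
theorem natCard_translates (W D : Submodule K V) {d e : ℕ}
    (he : finrank K (D ⊓ W : Submodule K V) = e) (hd : finrank K D = d + e) {a : ℕ}
    (x : Fin a → V) {r : ℕ}
    (hr : finrank K (W ⊔ D ⊔ Submodule.span K (Set.range x) : Submodule K V) =
      finrank K (W ⊔ D : Submodule K V) + r) (s : ℕ) :
    r ≤ a ∧ Nat.card {h : Fin a → D //
      finrank K (W ⊔ Submodule.span K (Set.range fun j => x j + h j) : Submodule K V) =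
        finrank K W + r + s} =
      Nat.card K ^ (a * e) * Nat.card K ^ (d * r) * rankCount (Nat.card K) d (a - r) s := by
  classical
  have : Finite V := Module.finite_of_finite K
  -- Modulo `W`, the space `D` has dimension `d`, and each vector gains a factor `Q^e` from `D ⊓ W`.
  -- Of the `x_j`, `r` are independent modulo `W ⊔ D` and can be translated freely; the other `a -
  -- r` behave like the columns of a `d × (a - r)` matrix that must have rank `s`. The induction
  -- adds `x 0` to the tail and follows the recursion of `rankCount`.
  induction a generalizing r s with
  | zero =>
    obtain rfl : r = 0 := by
      rw [Set.range_eq_empty, Submodule.span_empty, sup_bot_eq] at hr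
      omega
    refine ⟨le_rfl, ?_⟩
    have hW : ∀ h : Fin 0 → D, finrank K (W ⊔ Submodule.span K (Set.range fun j => x j + h j) :
        Submodule K V) = finrank K W := fun h => by
      rw [Set.range_eq_empty, Submodule.span_empty, sup_bot_eq]
    simp only [hW]
    cases s with
    | zero => simp [rankCount]
    | succ s => simp [rankCount]
  | succ a ih =>
    set Q := Nat.card K with hQ
    have hcons : Nat.card {h : Fin (a + 1) → D //
        finrank K (W ⊔ Submodule.span K (Set.range fun j => x j + h j) : Submodule K V) =
          finrank K W + r + s} =
        Nat.card {p : D × (Fin a → D) //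
          finrank K (W ⊔ Submodule.span K (Set.range fun j => Fin.tail x j + p.2 j) ⊔
            Submodule.span K {x 0 + (p.1 : V)} : Submodule K V) = finrank K W + r + s} := by
      refine (Nat.card_congr (Equiv.subtypeEquiv (Fin.consEquiv fun _ => D) fun p => ?_)).symm
      rw [sup_span_range_cons]
      rfl
    rw [sup_span_range_cons] at hr
    -- the dimension of `D ∩ U` is determined by that of `U`
    have hDU : ∀ {r' : ℕ} (h : Fin a → D),
        finrank K (W ⊔ D ⊔ Submodule.span K (Set.range (Fin.tail x)) : Submodule K V) =
          finrank K (W ⊔ D : Submodule K V) + r' →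
        finrank K (D ⊓ (W ⊔ Submodule.span K (Set.range fun j => Fin.tail x j + h j)) :
          Submodule K V) + finrank K W + r' = e +
        finrank K (W ⊔ Submodule.span K (Set.range fun j => Fin.tail x j + h j) :
          Submodule K V) := by
      intro r' h hr'
      have h1 := Submodule.finrank_sup_add_finrank_inf_eq
        (W ⊔ Submodule.span K (Set.range fun j => Fin.tail x j + h j)) D
      rw [sup_span_range_add_sup, hr', inf_comm] at h1
      have h2 := Submodule.finrank_sup_add_finrank_inf_eq W D
      rw [inf_comm, he] at h2
      omega
    -- If so, `x 0` acts as a new matrix column. The translates that do not enlarge the span form a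
    -- coset of size `Q^(e + s')`, where `s'` is the rank reached by the tail.
    by_cases hx : x 0 ∈ W ⊔ D ⊔ Submodule.span K (Set.range (Fin.tail x))
    · rw [sup_eq_left.mpr ((Submodule.span_singleton_le_iff_mem _ _).mpr hx)] at hr
      have hra := (ih (Fin.tail x) hr 0).1
      refine ⟨by omega, ?_⟩
      have hmem : ∀ h : Fin a → D, x 0 ∈
          W ⊔ Submodule.span K (Set.range fun j => Fin.tail x j + h j) ⊔ D := fun h => by
        rw [sup_span_range_add_sup]; exact hx
      have hsame : ∀ (h : Fin a → D) (s' : ℕ),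
          finrank K (W ⊔ Submodule.span K (Set.range fun j => Fin.tail x j + h j) :
            Submodule K V) = finrank K W + r + s' →
          Nat.card {y : D // x 0 + (y : V) ∈
            W ⊔ Submodule.span K (Set.range fun j => Fin.tail x j + h j)} = Q ^ (e + s') := by
        intro h s' hs'
        rw [natCard_translate_mem _ _ (hmem h)]
        congr 1
        have := hDU h hr
        omega
      have hdim : ∀ (h : Fin a → D) (y : D),
          finrank K (W ⊔ Submodule.span K (Set.range fun j => Fin.tail x j + h j) ⊔
            Submodule.span K {x 0 + (y : V)} : Submodule K V) =
          finrank K (W ⊔ Submodule.span K (Set.range fun j => Fin.tail x j + h j) :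
            Submodule K V) +
          if x 0 + (y : V) ∈ W ⊔ Submodule.span K (Set.range fun j => Fin.tail x j + h j)
          then 0 else 1 := by
        intro h y
        split_ifs with hy
        · rw [sup_eq_left.mpr ((Submodule.span_singleton_le_iff_mem _ _).mpr hy), add_zero]
        · exact Submodule.finrank_sup_span_singleton hy
      -- The rank is never below `r`, so for `s = 0` the tail cannot fall short by one.
      have hlow : ∀ h : Fin a → D, finrank K W + r ≤
          finrank K (W ⊔ Submodule.span K (Set.range fun j => Fin.tail x j + h j) :
            Submodule K V) := by
        intro h
        have h1 := hDU h hr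
        have h2 : e ≤ finrank K (D ⊓ (W ⊔ Submodule.span K
            (Set.range fun j => Fin.tail x j + h j)) : Submodule K V) := by
          rw [← he]
          exact Submodule.finrank_mono (inf_le_inf_left _ le_sup_left)
        omega
      rw [hcons]
      cases s with
      | zero =>
        rw [natCard_subtype_prod_of_fibers (P := fun (y : D) (h : Fin a → D) =>
          finrank K (W ⊔ Submodule.span K (Set.range fun j => Fin.tail x j + h j) ⊔
            Submodule.span K {x 0 + (y : V)} : Submodule K V) = finrank K W + r + 0)
          (A := fun h : Fin a → D =>
          finrank K (W ⊔ Submodule.span K (Set.range fun j => Fin.tail x j + h j) :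
            Submodule K V) = finrank K W + r + 0) (B := fun _ => False) (a := Q ^ e) (b := 0)
          (fun _ _ h => h) ?_ (fun _ h => h.elim) ?_, (ih (Fin.tail x) hr 0).2,
          show a + 1 - r = (a - r) + 1 by omega]
        · simp only [rankCount]
          ring
        · intro h hh
          rw [← add_zero e, ← hsame h 0 hh]
          refine Nat.card_congr (Equiv.subtypeEquivRight fun y => ?_)
          rw [hdim, hh]
          split_ifs with h' <;> simp [h']
        · intro h y hy
          left
          rw [hdim] at hy
          have := hlow h
          split_ifs at hy <;> omega
      | succ s =>
        rw [natCard_subtype_prod_of_fibers (P := fun (y : D) (h : Fin a → D) =>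
          finrank K (W ⊔ Submodule.span K (Set.range fun j => Fin.tail x j + h j) ⊔
            Submodule.span K {x 0 + (y : V)} : Submodule K V) = finrank K W + r + (s + 1))
          (A := fun h : Fin a → D =>
          finrank K (W ⊔ Submodule.span K (Set.range fun j => Fin.tail x j + h j) :
            Submodule K V) = finrank K W + r + (s + 1)) (B := fun h : Fin a → D =>
          finrank K (W ⊔ Submodule.span K (Set.range fun j => Fin.tail x j + h j) :
            Submodule K V) = finrank K W + r + s) (a := Q ^ (e + (s + 1)))
            (b := Q ^ (d + e) - Q ^ (e + s))
          (fun _ _ h => by omega) ?_ ?_ ?_, (ih (Fin.tail x) hr (s + 1)).2,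
          (ih (Fin.tail x) hr s).2, show a + 1 - r = (a - r) + 1 by omega]
        · simp only [rankCount]
          rw [show Q ^ (d + e) - Q ^ (e + s) = Q ^ e * (Q ^ d - Q ^ s) by
            rw [Nat.mul_sub, ← pow_add, ← pow_add, add_comm d]]
          ring
        · intro h hh
          rw [← hsame h (s + 1) hh]
          refine Nat.card_congr (Equiv.subtypeEquivRight fun y => ?_)
          rw [hdim, hh]
          split_ifs with h' <;> simp [h']
        · intro h hh
          rw [← hsame h s hh, ← hd, hQ, ← Module.natCard_eq_pow_finrank]
          have := Fintype.ofFinite D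
          rw [Nat.card_eq_fintype_card (α := D), Nat.card_eq_fintype_card (α := {y : D // x 0 +
              (y : V) ∈ W ⊔ Submodule.span K (Set.range fun j => Fin.tail x j + h j)}),
            ← Fintype.card_subtype_compl, Nat.card_eq_fintype_card.symm]
          refine Nat.card_congr (Equiv.subtypeEquivRight fun y => ?_)
          rw [hdim, hh]
          split_ifs with h' <;> simp [h', add_assoc]
        · intro h y hy
          rw [hdim] at hy
          split_ifs at hy
          · left; omega
          · right; omega
    -- Here every translate of `x 0` enlarges the span, so all `Q^(d + e)` translations are
    -- admissible.
    · rw [Submodule.finrank_sup_span_singleton hx] at hr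
      obtain ⟨r', hr'⟩ : ∃ r', finrank K (W ⊔ D ⊔ Submodule.span K (Set.range (Fin.tail x)) :
          Submodule K V) = finrank K (W ⊔ D : Submodule K V) + r' :=
        Nat.exists_eq_add_of_le (Submodule.finrank_mono le_sup_left)
      obtain rfl : r = r' + 1 := by omega
      have hra := (ih (Fin.tail x) hr' 0).1
      refine ⟨by omega, ?_⟩
      have hdim : ∀ (h : Fin a → D) (y : D),
          finrank K (W ⊔ Submodule.span K (Set.range fun j => Fin.tail x j + h j) ⊔
            Submodule.span K {x 0 + (y : V)} : Submodule K V) =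
          finrank K (W ⊔ Submodule.span K (Set.range fun j => Fin.tail x j + h j) :
            Submodule K V) + 1 := by
        intro h y
        refine Submodule.finrank_sup_span_singleton fun hy => hx ?_
        rw [← sup_span_range_add_sup W D _ h]
        have h1 := Submodule.sub_mem _ (Submodule.mem_sup_left (T := D) hy)
          (Submodule.mem_sup_right y.2)
        simpa using h1
      rw [hcons, natCard_subtype_prod_of_fibers (P := fun (y : D) (h : Fin a → D) =>
          finrank K (W ⊔ Submodule.span K (Set.range fun j => Fin.tail x j + h j) ⊔
            Submodule.span K {x 0 + (y : V)} : Submodule K V) = finrank K W + (r' + 1) + s)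
          (A := fun h : Fin a → D =>
          finrank K (W ⊔ Submodule.span K (Set.range fun j => Fin.tail x j + h j) :
            Submodule K V) = finrank K W + r' + s) (B := fun _ => False) (a := Q ^ (d + e)) (b := 0)
          (fun _ _ h => h) ?_ (fun _ h => h.elim) ?_, (ih (Fin.tail x) hr' s).2,
          show a + 1 - (r' + 1) = a - r' by omega]
      · ring
      · intro h hh
        rw [← hd, hQ, ← Module.natCard_eq_pow_finrank]
        refine Nat.card_congr (Equiv.subtypeUnivEquiv fun y => ?_)
        rw [hdim, hh]
        omega
      · intro h y hy
        left
        rw [hdim] at hy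
        omega

omit [Finite K] in
theorem finrank_map_add_eq_of_inf_ker_eq (f : V →ₗ[K] V) {p p' : Submodule K V}
    (h : p ⊓ LinearMap.ker f = p' ⊓ LinearMap.ker f) :
    finrank K p + finrank K (p'.map f) = finrank K p' + finrank K (p.map f) := by
  have h1 := finrank_map_add_finrank_inf_ker f p
  have h2 := finrank_map_add_finrank_inf_ker f p'
  rw [h] at h1
  omega

/-- The number of ways to extend an endomorphism `f` of a space `E` to an endomorphism of a space
of dimension `a` more, with image in `E` and with ranks of powers prescribed by `τ`. -/
theorem natCard_extensions (f : V →ₗ[K] V) {L : ℕ} {E : Submodule K V} (hE : E.map f ≤ E)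
    (hL : E.map (f ^ L) = ⊥) {μ : ℕ → ℕ}
    (hμ : ∀ i, finrank K (E.map (f ^ i) ⊓ LinearMap.ker f : Submodule K V) = μ i) {τ : ℕ → ℕ}
    (hτ : Antitone τ) (hτL : ∀ i, L ≤ i → τ i = 0) {a : ℕ} :
    Nat.card {x : Fin a → E // ∀ i, finrank K
      ((E.map f ⊔ Submodule.span K (Set.range fun j => (x j : V))).map (f ^ i)) =
        finrank K (E.map (f ^ (i + 1))) + τ i} =
      ∏ i ∈ Finset.range L, Nat.card K ^ (a * μ (i + 1)) *
        Nat.card K ^ ((μ i - μ (i + 1)) * τ (i + 1)) *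
        rankCount (Nat.card K) (μ i - μ (i + 1)) (a - τ (i + 1)) (τ i - τ (i + 1)) := by
  have : Finite V := Module.finite_of_finite K
  induction L generalizing E μ τ with
  | zero =>
    have hE0 : E = ⊥ := by rwa [pow_zero, Module.End.one_eq_id, Submodule.map_id] at hL
    subst hE0
    rw [Finset.prod_range_zero, Nat.card_eq_one_iff_unique]
    have hx : ∀ x : Fin a → (⊥ : Submodule K V), Submodule.span K
        (Set.range fun j => (x j : V)) = ⊥ := fun x => by
      rw [Submodule.span_eq_bot]
      rintro _ ⟨j, rfl⟩
      exact (Submodule.mem_bot K).mp (x j).2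
    refine ⟨⟨fun x y => Subtype.ext (Subsingleton.elim _ _)⟩, ⟨0, fun i => ?_⟩⟩
    rw [hx, hτL i (Nat.zero_le i)]
    rw [add_zero, Submodule.map_bot, bot_sup_eq, Submodule.map_bot, Submodule.map_bot]
  | succ L ih =>
    have hmap : ∀ i, (E.map f).map (f ^ i) = E.map (f ^ (i + 1)) := fun i => by
      rw [pow_succ, Module.End.mul_eq_comp, Submodule.map_comp]
    have hμ0 : finrank K (E ⊓ LinearMap.ker f : Submodule K V) = μ 0 := by
      rw [← hμ 0, pow_zero, Module.End.one_eq_id, Submodule.map_id]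
    have hμ1 : finrank K (E.map f ⊓ LinearMap.ker f : Submodule K V) = μ 1 := by
      rw [← hμ 1, pow_one]
    have hμle : μ 1 ≤ μ 0 := by
      rw [← hμ0, ← hμ1]
      exact Submodule.finrank_mono (inf_le_inf_right _ hE)
    -- The conditions on `x` with index at least 1 are the conditions on `f ∘ x` relative to `f E`,
    -- with `μ` and `τ` shifted. It remains to count, for each admissible `g = f ∘ x`, the lifts
    -- satisfying the condition of index 0.
    have ih' := ih (E := E.map f) (Submodule.map_mono hE) ((hmap L).trans hL)
      (μ := fun i => μ (i + 1)) (fun i => by rw [hmap]; exact hμ (i + 1))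
      (τ := fun i => τ (i + 1)) (fun i j hij => hτ (by omega)) (fun i hi => hτL _ (by omega))
    rw [Finset.prod_range_succ', ← ih', mul_comm]
    have hspan : ∀ x : Fin a → E,
        (E.map f ⊔ Submodule.span K (Set.range fun j => (x j : V))).map f =
        (E.map f).map f ⊔ Submodule.span K (Set.range fun j => f (x j)) := fun x => by
      rw [Submodule.map_sup, Submodule.map_span, ← Set.range_comp]
      rfl
    refine natCard_subtype_of_fibers
      (fun (x : Fin a → E) j => (⟨f (x j), Submodule.mem_map_of_mem (x j).2⟩ : E.map f)) ?_ ?_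
    · intro x hx i
      rw [← hspan x, hmap, ← hx (i + 1), pow_succ, Module.End.mul_eq_comp, Submodule.map_comp]
    · intro g hg
      choose x0 hx0 hx0g using fun j => (g j).2
      -- Both spaces meet `ker f` in exactly `E ⊓ ker f`, so the difference of their dimensions
      -- survives under `f`, where the condition of index 0 on `g` says that it is `τ 1`.
      have hr : finrank K (E.map f ⊔ (E ⊓ LinearMap.ker f) ⊔
          Submodule.span K (Set.range x0) : Submodule K V) =
          finrank K (E.map f ⊔ (E ⊓ LinearMap.ker f) : Submodule K V) + τ 1 := by
        have hspanE : Submodule.span K (Set.range x0) ≤ E := by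
          rw [Submodule.span_le]
          rintro _ ⟨j, rfl⟩
          exact hx0 j
        have h1 : ∀ p : Submodule K V, p ≤ E → (E.map f ⊔ (E ⊓ LinearMap.ker f) ⊔ p) ⊓
            LinearMap.ker f = E ⊓ LinearMap.ker f := fun p hp => by
          apply le_antisymm
          · exact inf_le_inf_right _ (sup_le (sup_le hE inf_le_left) hp)
          · exact le_inf (le_sup_right.trans le_sup_left) inf_le_right
        have h2 := finrank_map_add_eq_of_inf_ker_eq f
          ((h1 _ hspanE).trans (h1 ⊥ bot_le).symm)
        have h3 := hg 0
        have h4 : (E ⊓ LinearMap.ker f).map f = ⊥ := by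
          rw [eq_bot_iff, Submodule.map_le_iff_le_comap]
          exact inf_le_right
        have h5 : (E.map f ⊔ (E ⊓ LinearMap.ker f) ⊔ Submodule.span K (Set.range x0)).map f =
            (E.map f).map f ⊔ Submodule.span K (Set.range fun j => (g j : V)) := by
          rw [Submodule.map_sup, Submodule.map_sup, h4, sup_bot_eq, Submodule.map_span,
            ← Set.range_comp, show f ∘ x0 = fun j => (g j : V) from funext hx0g]
        have h6 : (E.map f ⊔ (E ⊓ LinearMap.ker f) ⊔ ⊥).map f = (E.map f).map f := by
          rw [sup_bot_eq, Submodule.map_sup, h4, sup_bot_eq]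
        rw [pow_zero, Module.End.one_eq_id, Submodule.map_id, zero_add, pow_one] at h3
        rw [h5, h6, h3, sup_bot_eq] at h2
        omega
      -- The lifts of `g` are the translates of `x0` by vectors of `E ⊓ ker f`, which meets `f E` in
      -- dimension `μ 1`.
      have hD := natCard_translates (E.map f) (E ⊓ LinearMap.ker f) (d := μ 0 - μ 1) (e := μ 1)
        (by rw [inf_right_comm, inf_eq_right.mpr hE, hμ1])
        (by rw [hμ0]; omega) x0 hr (τ 0 - τ 1)
      rw [← hD.2]
      symm
      refine Nat.card_congr
        { toFun := fun h => ⟨fun j => ⟨x0 j + h.1 j, E.add_mem (hx0 j) (h.1 j).2.1⟩, ?_, ?_⟩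
          invFun := fun x => ⟨fun j => ⟨x.1 j - x0 j, E.sub_mem (x.1 j).2 (hx0 j), ?_⟩, ?_⟩
          left_inv := fun h => Subtype.ext (funext fun j => Subtype.ext (by simp))
          right_inv := fun x => Subtype.ext (funext fun j => Subtype.ext (by simp)) }
      · funext j
        apply Subtype.ext
        simp only [map_add, hx0g]
        rw [show f (h.1 j) = 0 from (h.1 j).2.2, add_zero]
      · intro i
        cases i with
        | zero =>
          rw [pow_zero, Module.End.one_eq_id, Submodule.map_id, h.2, zero_add, pow_one]
          have := hτ (Nat.zero_le 1)
          omega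
        | succ i =>
          rw [pow_succ, Module.End.mul_eq_comp, Submodule.map_comp, hspan]
          have h5 := hg i
          rw [hmap] at h5
          rw [← h5]
          rw [show (fun j => f (x0 j + h.1 j)) = fun j => (g j : V) from funext fun j => by
            rw [map_add, hx0g, show f (h.1 j) = 0 from (h.1 j).2.2, add_zero]]
      · have h6 := congrArg (fun y => (y j : V)) x.2.1
        simp only at h6
        simp [h6, hx0g]
      · have h7 := x.2.2 0
        rw [pow_zero, Module.End.one_eq_id, Submodule.map_id, zero_add, pow_one] at h7
        have := hτ (Nat.zero_le 1)
        have h8 : (fun j => x0 j + ((x.1 j : V) - x0 j)) = fun j => (x.1 j : V) :=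
          funext fun j => add_sub_cancel _ _
        change finrank K (E.map f ⊔ Submodule.span K (Set.range fun j => x0 j + ((x.1 j : V) - x0 j)) :
          Submodule K V) = _
        rw [h8]
        omega

end Counting

end QWhittaker

namespace QWhittaker

/-! ### `q`-analogues and the closed formula for rank counts. -/

section QIdentities

variable {F : Type*} [Field F] (q : F)

theorem qFactorial_zero : qFactorial q 0 = 1 := by simp [qFactorial]

theorem qFactorial_succ (n : ℕ) : qFactorial q (n + 1) = qNumber q (n + 1) * qFactorial q n := by
  rw [qFactorial, qFactorial, Finset.prod_range_succ, mul_comm]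

theorem qNumber_zero : qNumber q 0 = 0 := by simp [qNumber]

theorem qNumber_add (m n : ℕ) : qNumber q (m + n) = qNumber q m + q ^ m * qNumber q n := by
  rw [qNumber, Finset.sum_range_add, qNumber, qNumber, Finset.mul_sum]
  simp_rw [pow_add]

theorem one_sub_mul_qNumber (n : ℕ) : (1 - q) * qNumber q n = 1 - q ^ n := by
  rw [qNumber, mul_neg_geom_sum]

end QIdentities

theorem qFactorial_pos {q : ℝ} (hq : 0 < q) (n : ℕ) : 0 < qFactorial q n :=
  Finset.prod_pos fun i _ => Finset.sum_pos (fun j _ => pow_pos hq j) ⟨0, by simp⟩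

theorem rankCount_eq_zero {Q d b s : ℕ} (h : b < s) : rankCount Q d b s = 0 := by
  induction b generalizing s with
  | zero =>
    obtain ⟨s, rfl⟩ := Nat.exists_eq_succ_of_ne_zero h.ne'
    rfl
  | succ b ih =>
    obtain ⟨s, rfl⟩ := Nat.exists_eq_succ_of_ne_zero (Nat.ne_zero_of_lt h)
    rw [rankCount, ih (by omega), ih (by omega), mul_zero, mul_zero, add_zero]

/-- The column recursion turns into the `q`-Pascal rule `[c + (s+1)]_q = [c]_q + q^c [s+1]_q`. The
numbers of rows and columns are written as `s + e` and `s + c` to avoid subtraction. -/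
theorem rankCount_mul_qFactorial {q : ℝ} {Q : ℕ} (hq : q * Q = 1) (hQ : 0 < Q) (s c e : ℕ) :
    (rankCount Q (s + e) (s + c) s : ℝ) *
      (qFactorial q e * qFactorial q c * qFactorial q s) =
    (Q : ℝ) ^ (s * (s + e + c)) * (1 - q) ^ s * (qFactorial q (s + e) * qFactorial q (s + c)) := by
  obtain ⟨b, hb⟩ : ∃ b, b = s + c := ⟨_, rfl⟩
  rw [← hb]
  induction b generalizing s c e with
  | zero =>
    obtain rfl : s = 0 := by omega
    obtain rfl : c = 0 := by omega
    simp [rankCount, qFactorial_zero]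
  | succ b ih =>
    cases s with
    | zero =>
      have h1 := ih 0 b e (by simp)
      obtain rfl : c = b + 1 := by omega
      have h2 : rankCount Q (0 + e) (b + 1) 0 = rankCount Q (0 + e) b 0 := rfl
      rw [h2]
      simp only [qFactorial_zero, zero_mul, pow_zero, one_mul, mul_one, zero_add] at h1 ⊢
      rw [qFactorial_succ]
      linear_combination qNumber q (b + 1) * h1
    | succ s =>
      have hsc : b = s + c := by omega
      have hrec : rankCount Q (s + 1 + e) (b + 1) (s + 1) =
          Q ^ (s + 1) * rankCount Q (s + 1 + e) b (s + 1) +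
            (Q ^ (s + 1 + e) - Q ^ s) * rankCount Q (s + 1 + e) b s := rfl
      have hqpow : ∀ k : ℕ, q ^ k * (Q : ℝ) ^ k = 1 := fun k => by rw [← mul_pow, hq, one_pow]
      have hsub : ((Q ^ (s + 1 + e) - Q ^ s : ℕ) : ℝ) =
          (Q : ℝ) ^ (s + 1 + e) * ((1 - q) * qNumber q (e + 1)) := by
        rw [Nat.cast_sub (Nat.pow_le_pow_right hQ (by omega)), one_sub_mul_qNumber]
        push_cast
        rw [show s + 1 + e = s + (e + 1) by ring, pow_add]
        linear_combination (Q : ℝ) ^ s * hqpow (e + 1)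
      -- The contribution of matrices whose first `b` columns already have full target rank. For `c
      -- = 0` there are none, in agreement with `[0]_q = 0`.
      have h1 : (rankCount Q (s + 1 + e) b (s + 1) : ℝ) *
          (qFactorial q e * qFactorial q c * qFactorial q (s + 1)) * (Q : ℝ) ^ (s + 1) =
          qNumber q c * ((Q : ℝ) ^ ((s + 1) * (s + 1 + e + c)) * (1 - q) ^ (s + 1) *
            (qFactorial q (s + 1 + e) * qFactorial q b)) := by
        cases c with
        | zero => rw [rankCount_eq_zero (by omega), qNumber_zero]; simp
        | succ c =>
          have h := ih (s + 1) c e (by omega)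
          rw [qFactorial_succ q c, show (s + 1) * (s + 1 + e + (c + 1)) =
            (s + 1) * (s + 1 + e + c) + (s + 1) by ring, pow_add]
          linear_combination (qNumber q (c + 1) * (Q : ℝ) ^ (s + 1)) * h
      have h2 := ih s c (e + 1) hsc
      rw [show s + (e + 1) = s + 1 + e by ring] at h2
      rw [hrec, Nat.cast_add, Nat.cast_mul, Nat.cast_mul, hsub,
        qFactorial_succ q b, qFactorial_succ q s, show b + 1 = c + (s + 1) by omega,
        qNumber_add q c (s + 1)]
      rw [qFactorial_succ q s] at h1
      rw [qFactorial_succ q e] at h2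
      have h3 : (Q : ℝ) ^ ((s + 1) * (s + 1 + e + c)) * q ^ c =
          (Q : ℝ) ^ (s + 1 + e) * (Q : ℝ) ^ (s * (s + 1 + e + c)) := by
        rw [show (s + 1) * (s + 1 + e + c) = (s + 1 + e) + s * (s + 1 + e + c) + c by ring, pow_add,
          pow_add]
        linear_combination ((Q : ℝ) ^ (s + 1 + e) * (Q : ℝ) ^ (s * (s + 1 + e + c))) * hqpow c
      push_cast
      linear_combination h1 + (Q : ℝ) ^ (s + 1 + e) * (1 - q) * qNumber q (s + 1) * h2 -
        (1 - q) ^ (s + 1) * qFactorial q (s + 1 + e) * qFactorial q b * qNumber q (s + 1) * h3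

theorem choose_two_add (x y : ℕ) : (x + y).choose 2 = x.choose 2 + y.choose 2 + x * y := by
  induction y with
  | zero => simp
  | succ y ih =>
    rw [← add_assoc, Nat.choose_succ_succ' (x + y) 1, Nat.choose_succ_succ' y 1, ih,
      Nat.choose_one_right, Nat.choose_one_right]
    ring

/-! ### Row-by-row telescoping along a horizontal strip. -/

section HorizontalStrip

variable {μ ν b : ℕ → ℕ}

/-- The left sum is the total exponent of `Q`. Once `μ M = ν M = 0` and `b M = a`, the identity says
that with `m = |μ|` it equals `a m + binom(a, 2)` minus the growth of `n(·)` from `μ` to `ν`, that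
is, the change of `binom(m, 2) - n(μ)`. The terms in `b M` make the partial sums inductive. -/
theorem sum_exponent_eq {a : ℕ} (hμν : ∀ i, μ i ≤ ν i) (hνμ : ∀ i, ν (i + 1) ≤ μ i)
    (hb0 : b 0 = ν 0 - μ 0) (hb : ∀ i, b (i + 1) = b i + (ν (i + 1) - μ (i + 1)))
    (hba : ∀ i, b i ≤ a) (M : ℕ) :
    ∑ i ∈ Finset.range M, (a * μ (i + 1) + (μ i - μ (i + 1)) * (a - b (i + 1)) +
      (ν (i + 1) - μ (i + 1)) * (μ i - μ (i + 1) + b i)) +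
      ∑ i ∈ Finset.range (M + 1), (ν i).choose 2 =
    a * ∑ i ∈ Finset.range M, μ i + (b M).choose 2 + b M * μ M +
      ∑ i ∈ Finset.range (M + 1), (μ i).choose 2 := by
  induction M with
  | zero =>
    obtain ⟨s, hs⟩ := Nat.exists_eq_add_of_le (hμν 0)
    simp only [Finset.range_zero, Finset.sum_empty, zero_add, mul_zero, Finset.sum_range_one, hb0,
      hs, choose_two_add, Nat.add_sub_cancel_left]
    ring
  | succ M ih =>
    rw [Finset.sum_range_succ, Finset.sum_range_succ _ (M + 1), Finset.sum_range_succ μ,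
      Finset.sum_range_succ (fun i => (μ i).choose 2) (M + 1)]
    obtain ⟨s, hs⟩ := Nat.exists_eq_add_of_le (hμν (M + 1))
    obtain ⟨e, he⟩ := Nat.exists_eq_add_of_le (hνμ M)
    have hb' := hb M
    obtain ⟨t, ht⟩ := Nat.exists_eq_add_of_le (hba (M + 1))
    rw [hs, Nat.add_sub_cancel_left] at hb'
    rw [show a - b (M + 1) = t by omega, show μ M - μ (M + 1) = s + e by omega,
      show ν (M + 1) - μ (M + 1) = s by omega, hs, hb', choose_two_add, choose_two_add]
    have ha : a = b M + s + t := by omega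
    have hμM : μ M = μ (M + 1) + s + e := by omega
    generalize ∑ i ∈ Finset.range M, (a * μ (i + 1) + (μ i - μ (i + 1)) * (a - b (i + 1)) +
      (ν (i + 1) - μ (i + 1)) * (μ i - μ (i + 1) + b i)) = S at ih ⊢
    rw [hμM] at ih ⊢
    rw [ha] at ih ⊢
    linarith [ih]

/-- The product formula for the number of extensions along a horizontal strip, in terms of
`q`-factorials. -/
theorem prod_rankCount_mul_qFactorial {q : ℝ} {Q : ℕ} (hq : q * Q = 1) (hQ : 0 < Q) {a : ℕ}
    (hμν : ∀ i, μ i ≤ ν i) (hνμ : ∀ i, ν (i + 1) ≤ μ i)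
    (hb0 : b 0 = ν 0 - μ 0) (hb : ∀ i, b (i + 1) = b i + (ν (i + 1) - μ (i + 1))) (M : ℕ) :
    (∏ i ∈ Finset.range M, ((Q ^ (a * μ (i + 1)) * Q ^ ((μ i - μ (i + 1)) * (a - b (i + 1))) *
      rankCount Q (μ i - μ (i + 1)) (b (i + 1)) (ν (i + 1) - μ (i + 1)) : ℕ) : ℝ)) *
      ((∏ i ∈ Finset.range M, qFactorial q (μ i - ν (i + 1))) *
        ∏ i ∈ Finset.range (M + 1), qFactorial q (ν i - μ i)) =
    (Q : ℝ) ^ (∑ i ∈ Finset.range M, (a * μ (i + 1) + (μ i - μ (i + 1)) * (a - b (i + 1)) +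
      (ν (i + 1) - μ (i + 1)) * (μ i - μ (i + 1) + b i))) * (1 - q) ^ (b M - b 0) *
      ((∏ i ∈ Finset.range M, qFactorial q (μ i - μ (i + 1))) * qFactorial q (b M)) := by
  have hb_ge : ∀ M, b 0 ≤ b M := fun M => by
    induction M with
    | zero => rfl
    | succ M ih => rw [hb]; omega
  induction M with
  | zero => simp [hb0]
  | succ M ih =>
    obtain ⟨s, hs⟩ := Nat.exists_eq_add_of_le (hμν (M + 1))
    obtain ⟨e, he⟩ := Nat.exists_eq_add_of_le (hνμ M)
    have hb' := hb M
    rw [hs, Nat.add_sub_cancel_left] at hb'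
    -- The factors `[b (M+1)]_q! / [b M]_q!` telescope; the initial `[b 0]_q!` is the factor of `ν 0
    -- - μ 0`.
    have key := rankCount_mul_qFactorial hq hQ s (b M) e
    have hbb := hb_ge M
    rw [Finset.prod_range_succ, Finset.prod_range_succ (fun i => qFactorial q (μ i - ν (i + 1))),
      Finset.prod_range_succ (fun i => qFactorial q (ν i - μ i)) (M + 1),
      Finset.sum_range_succ, Finset.prod_range_succ (fun i => qFactorial q (μ i - μ (i + 1)))]
    rw [show μ M - μ (M + 1) = s + e by omega, show ν (M + 1) - μ (M + 1) = s by omega,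
      show μ M - ν (M + 1) = e by omega, show b (M + 1) - b 0 = (b M - b 0) + s by omega,
      show b (M + 1) = s + b M by omega]
    have hcomm : s + b M = b M + s := add_comm _ _
    rw [hcomm] at key ⊢
    rw [Nat.cast_mul, Nat.cast_mul, pow_add (Q : ℝ),
      pow_add (Q : ℝ) (a * μ (M + 1) + (s + e) * (a - (b M + s))),
      pow_add (Q : ℝ) (a * μ (M + 1)), pow_add (1 - q)]
    push_cast at ih key ⊢
    linear_combination (rankCount Q (s + e) (b M + s) s * qFactorial q e * qFactorial q s *
      (Q : ℝ) ^ (a * μ (M + 1)) * (Q : ℝ) ^ ((s + e) * (a - (b M + s)))) * ih +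
      ((Q : ℝ) ^ (∑ i ∈ Finset.range M, (a * μ (i + 1) + (μ i - μ (i + 1)) * (a - b (i + 1)) +
      (ν (i + 1) - μ (i + 1)) * (μ i - μ (i + 1) + b i))) * (1 - q) ^ (b M - b 0) *
      (∏ i ∈ Finset.range M, qFactorial q (μ i - μ (i + 1))) * (Q : ℝ) ^ (a * μ (M + 1)) *
      (Q : ℝ) ^ ((s + e) * (a - (b M + s)))) * key

/-- The factor `q^(binom(m, 2) - n(μ)) (1-q)^(-m + μ_1) ∏ [μ_i - μ_{i+1}]_q!`, for a partition `μ`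
of `m` with at most `L` parts. -/
noncomputable def shapeFactor (q : ℝ) (L m : ℕ) (μ : ℕ → ℕ) : ℝ :=
  q ^ ((m.choose 2 : ℤ) - ((∑ i ∈ Finset.range L, (μ i).choose 2 : ℕ) : ℤ)) *
    (1 - q) ^ (-(m : ℤ) + (μ 0 : ℤ)) *
    ∏ i ∈ Finset.range L, qFactorial q (μ i - μ (i + 1))

/-- This is the one-step version of the theorem: adding a strip of size `a` changes the prefactor
exactly as required by the number of extensions. -/
theorem prod_qBinomial_mul_shapeFactor {q : ℝ} {Q : ℕ} (hq : q * Q = 1) (hQ : 0 < Q)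
    (hq1 : q < 1) {a L : ℕ}
    (hμν : ∀ i, μ i ≤ ν i) (hνμ : ∀ i, ν (i + 1) ≤ μ i) (hνL : ν L = 0)
    (hb0 : b 0 = ν 0 - μ 0) (hb : ∀ i, b (i + 1) = b i + (ν (i + 1) - μ (i + 1)))
    (hba : ∀ i, b i ≤ a) (hbL : b L = a) :
    (∏ i ∈ Finset.range L, qBinomial q (ν i - ν (i + 1)) (ν i - μ i)) * qFactorial q a *
      shapeFactor q L (∑ i ∈ Finset.range L, μ i) μ =
    shapeFactor q L (∑ i ∈ Finset.range L, μ i + a) ν *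
      ((∏ i ∈ Finset.range L, (Q ^ (a * μ (i + 1)) * Q ^ ((μ i - μ (i + 1)) * (a - b (i + 1))) *
      rankCount Q (μ i - μ (i + 1)) (b (i + 1)) (ν (i + 1) - μ (i + 1))) : ℕ) : ℝ) := by
  have hq0 : 0 < q := by
    have : (0 : ℝ) < Q := by exact_mod_cast hQ
    exact pos_of_mul_pos_left (hq ▸ one_pos) this.le
  have hμL : μ L = 0 := by have := hμν L; omega
  have h1 := prod_rankCount_mul_qFactorial hq hQ (a := a) hμν hνμ hb0 hb L
  have h2 := sum_exponent_eq hμν hνμ hb0 hb hba L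
  rw [Finset.sum_range_succ, Finset.sum_range_succ _ L, hνL, hμL, hbL] at h2
  rw [Finset.prod_range_succ _ L, hνL, hμL, Nat.sub_self, qFactorial_zero, mul_one, hbL] at h1
  rw [Nat.cast_prod]
  generalize ∑ i ∈ Finset.range L, (a * μ (i + 1) + (μ i - μ (i + 1)) * (a - b (i + 1)) +
      (ν (i + 1) - μ (i + 1)) * (μ i - μ (i + 1) + b i)) = N at h1 h2
  have h3 : ∏ i ∈ Finset.range L, qBinomial q (ν i - ν (i + 1)) (ν i - μ i) =
      (∏ i ∈ Finset.range L, qFactorial q (ν i - ν (i + 1))) /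
      ((∏ i ∈ Finset.range L, qFactorial q (μ i - ν (i + 1))) *
        ∏ i ∈ Finset.range L, qFactorial q (ν i - μ i)) := by
    rw [mul_comm (∏ i ∈ Finset.range L, qFactorial q (μ i - ν (i + 1))), ← Finset.prod_mul_distrib,
      ← Finset.prod_div_distrib]
    refine Finset.prod_congr rfl fun i _ => ?_
    have := hμν i
    have := hνμ i
    rw [qBinomial, show ν i - ν (i + 1) - (ν i - μ i) = μ i - ν (i + 1) by omega]
  have hne : (∏ i ∈ Finset.range L, qFactorial q (μ i - ν (i + 1))) *
      ∏ i ∈ Finset.range L, qFactorial q (ν i - μ i) ≠ 0 :=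
    (mul_pos (Finset.prod_pos fun i _ => qFactorial_pos hq0 _)
      (Finset.prod_pos fun i _ => qFactorial_pos hq0 _)).ne'
  -- The scalar parts of the two prefactors differ by `Q^N (1-q)^(a - b 0)`: the exponent of `q` is
  -- `sum_exponent_eq`, and that of `1 - q` uses `b 0 = ν 0 - μ 0`.
  have h4 : q ^ (((∑ i ∈ Finset.range L, μ i).choose 2 : ℤ) -
      ((∑ i ∈ Finset.range L, (μ i).choose 2 : ℕ) : ℤ)) *
      (1 - q) ^ (-((∑ i ∈ Finset.range L, μ i : ℕ) : ℤ) + (μ 0 : ℤ)) =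
      q ^ (((∑ i ∈ Finset.range L, μ i + a).choose 2 : ℤ) -
      ((∑ i ∈ Finset.range L, (ν i).choose 2 : ℕ) : ℤ)) *
      (1 - q) ^ (-((∑ i ∈ Finset.range L, μ i + a : ℕ) : ℤ) + (ν 0 : ℤ)) *
      ((Q : ℝ) ^ N * (1 - q) ^ (a - b 0)) := by
    have hQq : (Q : ℝ) ^ N = q ^ (-(N : ℤ)) := by
      rw [zpow_neg, zpow_natCast, ← inv_pow, eq_inv_of_mul_eq_one_right hq]
    rw [hQq, ← zpow_natCast (1 - q), mul_mul_mul_comm, ← zpow_add₀ hq0.ne',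
      ← zpow_add₀ (sub_pos.mpr hq1).ne']
    rw [choose_two_add]
    generalize ∑ i ∈ Finset.range L, μ i = m at *
    have hb0a := hba 0
    have hμν0 := hμν 0
    congr 2
    · zify at h2
      push_cast
      simp only [Nat.choose_zero_succ, Nat.cast_zero, mul_zero, add_zero] at h2
      linear_combination h2
    · omega
  unfold shapeFactor
  rw [h4, h3, div_mul_eq_mul_div, div_mul_eq_mul_div, div_eq_iff hne]
  linear_combination (-(q ^ (((∑ i ∈ Finset.range L, μ i + a).choose 2 : ℤ) -
      ((∑ i ∈ Finset.range L, (ν i).choose 2 : ℕ) : ℤ)) *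
      (1 - q) ^ (-((∑ i ∈ Finset.range L, μ i + a : ℕ) : ℤ) + (ν 0 : ℤ)) *
      ∏ i ∈ Finset.range L, qFactorial q (ν i - ν (i + 1)))) * h1

end HorizontalStrip

end QWhittaker

namespace QWhittaker

open Module

/-! ### Partial sums of a weak composition. -/

section PartialSums

variable (α : ℕ →₀ ℕ)

theorem partialSum_zero : partialSum α 0 = 0 := by simp [partialSum]

theorem partialSum_succ (k : ℕ) : partialSum α (k + 1) = partialSum α k + α k := by
  rw [partialSum, partialSum, Finset.sum_range_succ]

theorem partialSum_eq_degree {k : ℕ} (hk : ∀ i, k ≤ i → α i = 0) :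
    partialSum α k = α.degree := by
  rw [Finsupp.degree_apply, partialSum]
  refine (Finset.sum_subset (fun i hi => ?_) fun i _ hi => Finsupp.notMem_support_iff.mp hi).symm
  rw [Finset.mem_range]
  by_contra hcon
  exact Finsupp.mem_support_iff.mp hi (hk i (by omega))

theorem exists_forall_ge_eq_zero : ∃ k, ∀ i, k ≤ i → α i = 0 := by
  obtain ⟨k, hk⟩ := α.support.exists_nat_subset_range
  refine ⟨k, fun i hi => ?_⟩
  by_contra h
  have := Finset.mem_range.mp (hk (Finsupp.mem_support_iff.mpr h))
  omega

variable {α}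

theorem exists_mem_block {n : ℕ} (hα : α.degree = n) (c : Fin n) : ∃ j, c ∈ block n α j := by
  obtain ⟨k, hk⟩ := exists_forall_ge_eq_zero α
  have hex : ∃ k, (c : ℕ) < partialSum α k := ⟨k, by rw [partialSum_eq_degree α hk, hα]; exact c.2⟩
  have hspec := Nat.find_spec hex
  obtain ⟨j, hj⟩ : ∃ j, Nat.find hex = j + 1 := by
    refine Nat.exists_eq_succ_of_ne_zero fun h0 => ?_
    rw [h0, partialSum_zero] at hspec
    exact Nat.not_lt_zero _ hspec
  refine ⟨j, ?_, hj ▸ hspec⟩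
  have := Nat.find_min hex (m := j) (by omega)
  omega

end PartialSums

/-! ### Endomorphisms given by columns, and their restrictions to the standard flag. -/

section Columns

variable {K : Type*} [Field K] {n : ℕ} {α : ℕ →₀ ℕ} (hα : α.degree = n)

theorem map_linearCombination_standardFlag (y : Fin n → Fin n → K) (k : ℕ) :
    ((standardFlag K α hα).space k).map (Fintype.linearCombination K y) =
      Submodule.span K (y '' {c | (c : ℕ) < partialSum α k}) := by
  change (Submodule.span K _).map _ = _
  rw [Submodule.map_span, Set.image_image]
  simp [Fintype.linearCombination_apply_single]

theorem mem_standardFlag_iff (x : Fin n → K) (k : ℕ) :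
    x ∈ (standardFlag K α hα).space k ↔ ∀ c : Fin n, partialSum α k ≤ c → x c = 0 := by
  constructor
  · intro hx c hc
    have h : (standardFlag K α hα).space k ≤ LinearMap.ker (LinearMap.proj (R := K)
        (φ := fun _ : Fin n => K) c) := by
      refine Submodule.span_le.mpr ?_
      rintro _ ⟨j, hj, rfl⟩
      have hj' : (j : ℕ) < partialSum α k := hj
      have hne : c ≠ j := fun h => by subst h; omega
      simp [hne]
    exact h hx
  · intro hx
    rw [pi_eq_sum_univ' x]
    refine Submodule.sum_mem _ fun c _ => ?_
    by_cases hc : partialSum α k ≤ c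
    · rw [hx c hc, zero_smul]
      exact Submodule.zero_mem _
    · exact Submodule.smul_mem _ _ (Submodule.subset_span ⟨c, not_le.mp hc, by ext; simp [Pi.single_apply]⟩)

theorem strictlyCompatible_linearCombination_iff (y : Fin n → Fin n → K) :
    StrictlyCompatible (standardFlag K α hα) (Fintype.linearCombination K y) ↔
      ∀ m (c : Fin n), (c : ℕ) < partialSum α (m + 1) →
        y c ∈ (standardFlag K α hα).space m := by
  refine forall_congr' fun m => ?_
  rw [map_linearCombination_standardFlag, Submodule.span_le, Set.image_subset_iff]
  rfl

theorem toLin'_eq_linearCombination (N : Matrix (Fin n) (Fin n) K) :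
    Matrix.toLin' N = Fintype.linearCombination K fun c r => N r c := by
  ext c r
  simp [Fintype.linearCombination_apply, Pi.single_apply, ite_apply]

/-- Both conditions say that a column of block `j` vanishes from row `partialSum α j` on; every row
and column belongs to some block because `α` has size `n`. -/
theorem mem_nilradical_iff (N : Matrix (Fin n) (Fin n) K) :
    N ∈ nilradical K n α ↔ StrictlyCompatible (standardFlag K α hα) (Matrix.toLin' N) := by
  rw [toLin'_eq_linearCombination, strictlyCompatible_linearCombination_iff]
  simp only [mem_standardFlag_iff]
  constructor
  · intro h m c hc r hr
    obtain ⟨j, hj⟩ := exists_mem_block hα c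
    obtain ⟨i, hi⟩ := exists_mem_block hα r
    refine h i j ?_ r hi c hj
    by_contra hij
    rcases Nat.lt_or_ge i m with him | him
    · have := partialSum_mono α (show i + 1 ≤ m by omega)
      have := hi.2
      omega
    · have := partialSum_mono α (show m + 1 ≤ j by omega)
      have := hj.1
      omega
  · intro h i j hji r hr c hc
    exact h j c hc.2 r ((partialSum_mono α hji).trans hr.1)

theorem map_pow_eq_of_eqOn {V : Type*} [AddCommGroup V] [Module K V] {f g : V →ₗ[K] V}
    {P W : Submodule K V} (hfg : ∀ x ∈ P, f x = g x) (hP : P.map f ≤ P) (hW : W ≤ P) (i : ℕ) :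
    W.map (f ^ i) = W.map (g ^ i) := by
  have h : ∀ i, ∀ x ∈ P, (f ^ i) x ∈ P ∧ (f ^ i) x = (g ^ i) x := by
    intro i
    induction i with
    | zero => exact fun x hx => ⟨hx, rfl⟩
    | succ i ih =>
      intro x hx
      obtain ⟨h1, h2⟩ := ih x hx
      rw [pow_succ', pow_succ', Module.End.mul_apply, Module.End.mul_apply, ← h2, ← hfg _ h1]
      exact ⟨hP (Submodule.mem_map_of_mem h1), rfl⟩
  ext z
  simp only [Submodule.mem_map]
  exact exists_congr fun x => and_congr_right fun hx => by rw [(h i x (hW hx)).2]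

theorem linearCombination_eqOn {y y' : Fin n → Fin n → K} {k : ℕ}
    (h : ∀ c : Fin n, (c : ℕ) < partialSum α k → y c = y' c) :
    ∀ x ∈ (standardFlag K α hα).space k,
      Fintype.linearCombination K y x = Fintype.linearCombination K y' x := by
  intro x hx
  rw [Fintype.linearCombination_apply, Fintype.linearCombination_apply]
  refine Finset.sum_congr rfl fun c _ => ?_
  by_cases hc : (c : ℕ) < partialSum α k
  · rw [h c hc]
  · rw [(mem_standardFlag_iff hα x k).mp hx c (not_lt.mp hc), zero_smul, zero_smul]

/-- The endomorphisms of `K^n`, given by their columns, which are strictly compatible with the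
standard flag, vanish on the unit vectors outside its `k`-th space, and whose restrictions to the
first `k` spaces have conjugated Jordan forms `S 0, …, S k`. -/
def HasShapesUpTo (S : ℕ → YoungDiagram) (k : ℕ) (y : Fin n → Fin n → K) : Prop :=
  (∀ c : Fin n, partialSum α k ≤ c → y c = 0) ∧
    (∀ m (c : Fin n), (c : ℕ) < partialSum α (m + 1) → y c ∈ (standardFlag K α hα).space m) ∧
    ∀ m ≤ k, ∀ i, finrank K (((standardFlag K α hα).space m).map
      (Fintype.linearCombination K y ^ i)) = tailCard (S m) i

theorem map_standardFlag_le {y : Fin n → Fin n → K}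
    (hy : ∀ m (c : Fin n), (c : ℕ) < partialSum α (m + 1) → y c ∈ (standardFlag K α hα).space m)
    (k : ℕ) : ((standardFlag K α hα).space k).map (Fintype.linearCombination K y) ≤
      (standardFlag K α hα).space k := by
  have h : StrictlyCompatible (standardFlag K α hα) (Fintype.linearCombination K y) :=
    (strictlyCompatible_linearCombination_iff hα y).mpr hy
  rintro _ ⟨x, hx, rfl⟩
  exact h.mapsTo k x hx

theorem map_standardFlag_succ {y : Fin n → Fin n → K} {k : ℕ} (x : Fin (α k) → Fin n → K)
    (hx : ∀ (c : Fin n) (j : Fin (α k)), (c : ℕ) = partialSum α k + j → y c = x j) :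
    ((standardFlag K α hα).space (k + 1)).map (Fintype.linearCombination K y) =
      ((standardFlag K α hα).space k).map (Fintype.linearCombination K y) ⊔
        Submodule.span K (Set.range x) := by
  have hn : partialSum α (k + 1) ≤ n := hα ▸ partialSum_le_degree α (k + 1)
  have hsucc := partialSum_succ α k
  rw [map_linearCombination_standardFlag, map_linearCombination_standardFlag, ← Submodule.span_union]
  congr 1
  apply Set.Subset.antisymm
  · rintro _ ⟨c, hc, rfl⟩
    have hc' : (c : ℕ) < partialSum α (k + 1) := hc
    by_cases h : (c : ℕ) < partialSum α k
    · exact Or.inl ⟨c, h, rfl⟩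
    · refine Or.inr ⟨⟨c - partialSum α k, by omega⟩, (hx c _ ?_).symm⟩
      simp only
      omega
  · rintro _ (⟨c, hc, rfl⟩ | ⟨j, rfl⟩)
    · exact ⟨c, lt_of_lt_of_le hc (partialSum_mono α (Nat.le_succ k)), rfl⟩
    · have hj := j.2
      refine ⟨⟨partialSum α k + j, by omega⟩, ?_, hx _ j rfl⟩
      change partialSum α k + j < partialSum α (k + 1)
      omega

theorem tailCard_mono {mu nu : YoungDiagram} (h : mu ≤ nu) (i : ℕ) :
    tailCard mu i ≤ tailCard nu i :=
  Finset.card_le_card (Finset.filter_subset_filter _ (YoungDiagram.cells_subset_iff.mpr h))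

/-- An extension of `y'` amounts to the columns of block `k`, which strict compatibility places in
the `k`-th space. The new rank conditions become those counted by `natCard_extensions`, since
`N^(i+1)(E_{k+1}) = N^i(N E_k + span x)` and `N` may be replaced by `y'` on `E_k`. -/
theorem natCard_fiber_hasShapesUpTo [Finite K] {S : ℕ → YoungDiagram} (hS : Monotone S)
    (hcard : ∀ m, (S m).card = partialSum α m) {k : ℕ} {y' : Fin n → Fin n → K}
    (hy' : HasShapesUpTo hα S k y') :
    Nat.card {y : Fin n → Fin n → K // (fun c : Fin n => if (c : ℕ) < partialSum α k then y c else 0) = y' ∧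
      HasShapesUpTo hα S (k + 1) y} =
    Nat.card {x : Fin (α k) → (standardFlag K α hα).space k // ∀ i, finrank K
      ((((standardFlag K α hα).space k).map (Fintype.linearCombination K y') ⊔
        Submodule.span K (Set.range fun j => (x j : Fin n → K))).map
          (Fintype.linearCombination K y' ^ i)) =
        finrank K (((standardFlag K α hα).space k).map
          (Fintype.linearCombination K y' ^ (i + 1))) +
          (tailCard (S (k + 1)) (i + 1) - tailCard (S k) (i + 1))} := by
  have hn : partialSum α (k + 1) ≤ n := hα ▸ partialSum_le_degree α (k + 1)
  have hsucc := partialSum_succ α k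
  have htail : ∀ i, tailCard (S k) i ≤ tailCard (S (k + 1)) i :=
    tailCard_mono (hS (Nat.le_succ k))
  -- ranks on the next space of the flag
  have hnext : ∀ (y : Fin n → Fin n → K) (x : Fin (α k) → (standardFlag K α hα).space k),
      (∀ m (c : Fin n), (c : ℕ) < partialSum α (m + 1) → y c ∈ (standardFlag K α hα).space m) →
      (∀ c : Fin n, (c : ℕ) < partialSum α k → y c = y' c) →
      (∀ (c : Fin n) (j : Fin (α k)), (c : ℕ) = partialSum α k + j → y c = x j) → ∀ i,
      ((standardFlag K α hα).space (k + 1)).map (Fintype.linearCombination K y ^ (i + 1)) =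
      (((standardFlag K α hα).space k).map (Fintype.linearCombination K y') ⊔
        Submodule.span K (Set.range fun j => (x j : Fin n → K))).map
          (Fintype.linearCombination K y' ^ i) := by
    intro y x hy hyy' hyx i
    have hagree := linearCombination_eqOn hα hyy'
    have hmap := map_pow_eq_of_eqOn hagree (map_standardFlag_le hα hy k) le_rfl 1
    rw [pow_one, pow_one] at hmap
    rw [pow_succ, Module.End.mul_eq_comp, Submodule.map_comp,
      map_standardFlag_succ hα (fun j => (x j : Fin n → K)) hyx, hmap]
    refine map_pow_eq_of_eqOn hagree (map_standardFlag_le hα hy k) (sup_le ?_ ?_) i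
    · rw [← hmap]
      exact map_standardFlag_le hα hy k
    · rw [Submodule.span_le]
      rintro _ ⟨j, rfl⟩
      exact (x j).2
  have hlow : ∀ (y : Fin n → Fin n → K),
      (∀ m (c : Fin n), (c : ℕ) < partialSum α (m + 1) → y c ∈ (standardFlag K α hα).space m) →
      (∀ c : Fin n, (c : ℕ) < partialSum α k → y c = y' c) → ∀ m ≤ k, ∀ i,
      ((standardFlag K α hα).space m).map (Fintype.linearCombination K y ^ i) =
      ((standardFlag K α hα).space m).map (Fintype.linearCombination K y' ^ i) := by
    intro y hy hyy' m hm i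
    exact map_pow_eq_of_eqOn (linearCombination_eqOn hα hyy') (map_standardFlag_le hα hy k)
      ((standardFlag K α hα).mono hm) i
  have hy'E : ∀ i, finrank K (((standardFlag K α hα).space k).map
      (Fintype.linearCombination K y' ^ i)) = tailCard (S k) i := hy'.2.2 k le_rfl
  have hext_lt : ∀ (x : Fin (α k) → (standardFlag K α hα).space k) (c : Fin n),
      (c : ℕ) < partialSum α k →
      (if h : partialSum α k ≤ c ∧ (c : ℕ) < partialSum α (k + 1) then
        (x ⟨c - partialSum α k, by omega⟩ : Fin n → K) else y' c) = y' c := fun x c hc => by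
    rw [dif_neg (by omega)]
  refine Nat.card_congr
    { toFun := fun y => ⟨fun j => ⟨y.1 ⟨partialSum α k + j, by omega⟩,
        y.2.2.2.1 k _ (by have := j.2; simp only; omega)⟩, ?_⟩
      invFun := fun x => ⟨fun c => if h : partialSum α k ≤ c ∧ (c : ℕ) < partialSum α (k + 1) then
        x.1 ⟨c - partialSum α k, by omega⟩ else y' c, ?_, ?_⟩
      left_inv := ?_
      right_inv := ?_ }
  · obtain ⟨y, hyy', hy0, hy, hrank⟩ := y
    intro i
    have hyy'' : ∀ c : Fin n, (c : ℕ) < partialSum α k → y c = y' c := fun c hc => by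
      rw [← hyy']; exact (if_pos hc).symm
    rw [← hnext y (fun j => ⟨y ⟨partialSum α k + j, by omega⟩, _⟩) hy hyy''
      (fun c j hcj => by congr; exact Fin.ext hcj) i, hrank (k + 1) le_rfl, hy'E]
    have := htail (i + 1)
    omega
  · funext c
    by_cases h1 : (c : ℕ) < partialSum α k
    · exact (if_pos h1).trans (hext_lt x.1 c h1)
    · exact (if_neg h1).trans (hy'.1 c (not_lt.mp h1)).symm
  · have hcomp : ∀ m (c : Fin n), (c : ℕ) < partialSum α (m + 1) →
        (if h : partialSum α k ≤ c ∧ (c : ℕ) < partialSum α (k + 1) then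
          (x.1 ⟨c - partialSum α k, by omega⟩ : Fin n → K) else y' c) ∈
          (standardFlag K α hα).space m := by
      intro m c hc
      split_ifs with h
      · refine (standardFlag K α hα).mono ?_ (x.1 _).2
        by_contra hmk
        have := partialSum_mono α (show m + 1 ≤ k by omega)
        omega
      · exact hy'.2.1 m c hc
    refine ⟨?_, hcomp, ?_⟩
    · intro c hc
      simp only
      rw [dif_neg (by omega)]
      exact hy'.1 c (by omega)
    · intro m hm i
      rcases Nat.lt_or_ge k m with hkm | hkm
      · obtain rfl : m = k + 1 := by omega
        cases i with
        -- The condition of index 0 is only that the dimension of the flag space is the size of the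
        -- shape.
        | zero =>
          rw [pow_zero, Module.End.one_eq_id, Submodule.map_id,
            (standardFlag K α hα).finrank_eq, tailCard_zero, hcard]
        | succ i =>
          rw [hnext _ x.1 hcomp (hext_lt x.1) ?_ i, x.2 i, hy'E]
          · have := htail (i + 1)
            omega
          · intro c j hcj
            have hj := j.2
            rw [dif_pos (by omega)]
            exact congrArg (fun z => (x.1 z : Fin n → K)) (Fin.ext (by simp only; omega))
      · rw [hlow _ hcomp (hext_lt x.1) m hkm i]
        exact hy'.2.2 m hkm i
  · rintro ⟨y, hyy', hy0, hy, hrank⟩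
    apply Subtype.ext
    funext c
    simp only
    split_ifs with h
    · congr
      omega
    · rw [← hyy']
      by_cases h1 : (c : ℕ) < partialSum α k
      · exact if_pos h1
      · exact (if_neg h1).trans (hy0 c (by omega)).symm
  · rintro ⟨x, hx⟩
    apply Subtype.ext
    funext j
    apply Subtype.ext
    have hj := j.2
    simp only
    rw [dif_pos (by omega)]
    congr
    omega

end Columns

end QWhittaker

namespace QWhittaker

open Module

/-! ### The count for a chain of shapes as a product over its strips. -/

section ProductFormula

theorem rowLen_mono {mu nu : YoungDiagram} (h : mu ≤ nu) (i : ℕ) : mu.rowLen i ≤ nu.rowLen i :=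
  le_of_forall_lt fun _ hj =>
    YoungDiagram.mem_iff_lt_rowLen.mp (h (YoungDiagram.mem_iff_lt_rowLen.mpr hj))

theorem colLen_le_of_rowLen_eq_zero {mu : YoungDiagram} {L : ℕ} (h : mu.rowLen L = 0) :
    mu.colLen 0 ≤ L := by
  by_contra hcon
  have := YoungDiagram.mem_iff_lt_rowLen.mp
    (YoungDiagram.mem_iff_lt_colLen.mpr (not_le.mp hcon))
  omega

theorem card_eq_sum_rowLen {mu : YoungDiagram} {L : ℕ} (h : mu.rowLen L = 0) :
    ∑ i ∈ Finset.range L, mu.rowLen i = mu.card := by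
  have key : ∀ M, ∑ i ∈ Finset.range M, mu.rowLen i + tailCard mu M = mu.card := by
    intro M
    induction M with
    | zero => rw [Finset.sum_range_zero, zero_add, tailCard_zero]
    | succ M ih => rw [Finset.sum_range_succ, add_assoc, ← tailCard_eq_add, ih]
  rw [← key L, tailCard_eq_zero (colLen_le_of_rowLen_eq_zero h), add_zero]

variable {K : Type*} [Field K] [Finite K] {n : ℕ} {α : ℕ →₀ ℕ} (hα : α.degree = n)

omit [Finite K] in
theorem natCard_hasShapesUpTo_zero {S : ℕ → YoungDiagram} (hS0 : (S 0).card = 0) :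
    Nat.card {y : Fin n → Fin n → K // HasShapesUpTo hα S 0 y} = 1 := by
  rw [Nat.card_eq_one_iff_unique]
  have h0 : ∀ i, tailCard (S 0) i = 0 := fun i =>
    Nat.le_zero.mp (((Finset.card_filter_le _ _).trans_eq hS0))
  refine ⟨⟨fun y y' => Subtype.ext (funext fun c => ?_)⟩, ⟨0, ?_, ?_, ?_⟩⟩
  · rw [y.2.1 c (by rw [partialSum_zero]; omega), y'.2.1 c (by rw [partialSum_zero]; omega)]
  · exact fun _ _ => rfl
  · exact fun m c _ => Submodule.zero_mem _
  · intro m hm i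
    obtain rfl : m = 0 := by omega
    have hE : (standardFlag K α hα).space 0 = ⊥ := by
      rw [← Submodule.finrank_eq_zero (R := K), (standardFlag K α hα).finrank_eq, partialSum_zero]
    rw [hE, Submodule.map_bot, finrank_bot, h0]

omit [Finite K] in
theorem finrank_map_inf_ker_of_hasShapesUpTo {S : ℕ → YoungDiagram} {k : ℕ}
    {y : Fin n → Fin n → K} (hy : HasShapesUpTo hα S k y) (i : ℕ) :
    finrank K (((standardFlag K α hα).space k).map (Fintype.linearCombination K y ^ i) ⊓
      LinearMap.ker (Fintype.linearCombination K y) : Submodule K (Fin n → K)) =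
      (S k).rowLen i := by
  have h1 := finrank_map_add_finrank_inf_ker (Fintype.linearCombination K y)
    (((standardFlag K α hα).space k).map (Fintype.linearCombination K y ^ i))
  rw [← Submodule.map_comp, ← Module.End.mul_eq_comp, ← pow_succ', hy.2.2 k le_rfl,
    hy.2.2 k le_rfl, tailCard_eq_add _ i] at h1
  omega

/-- The fibres of truncation to the first `k` blocks all have the same size, so the count gains one
factor per strip, and the shape factors telescope from the value 1 at the empty shape. -/
theorem prod_qBinomial_eq_natCard_hasShapesUpTo {q : ℝ} (hq : q * (Nat.card K : ℝ) = 1)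
    (hq1 : q < 1) {S : ℕ → YoungDiagram} (hS : Monotone S)
    (hstrip : ∀ m i, (S (m + 1)).rowLen (i + 1) ≤ (S m).rowLen i)
    (hcard : ∀ m, (S m).card = partialSum α m) {L : ℕ} (hL : ∀ m, (S m).rowLen L = 0) (k : ℕ) :
    (∏ j ∈ Finset.range k, ∏ i ∈ Finset.range L,
      qBinomial q ((S (j + 1)).rowLen i - (S (j + 1)).rowLen (i + 1))
        ((S (j + 1)).rowLen i - (S j).rowLen i)) * ∏ j ∈ Finset.range k, qFactorial q (α j) =
    shapeFactor q L (partialSum α k) (S k).rowLen *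
      (Nat.card {y : Fin n → Fin n → K // HasShapesUpTo hα S k y} : ℝ) := by
  induction k with
  | zero =>
    have h0 : ∀ i, (S 0).rowLen i = 0 := fun i => by
      have h1 := tailCard_eq_add (S 0) i
      have h2 : tailCard (S 0) i ≤ (S 0).card := Finset.card_filter_le _ _
      rw [hcard, partialSum_zero] at h2
      omega
    rw [natCard_hasShapesUpTo_zero hα ((hcard 0).trans (partialSum_zero α))]
    simp [shapeFactor, h0, partialSum_zero, qFactorial_zero]
  | succ k ih =>
    have hQ : 0 < Nat.card K := Nat.card_pos
    have hsucc := partialSum_succ α k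
    have htailL : ∀ m i, L ≤ i → tailCard (S m) i = 0 := fun m i hi =>
      tailCard_eq_zero ((colLen_le_of_rowLen_eq_zero (hL m)).trans hi)
    have hle : ∀ i, tailCard (S k) i ≤ tailCard (S (k + 1)) i :=
      tailCard_mono (hS (Nat.le_succ k))
    have hμν : ∀ i, (S k).rowLen i ≤ (S (k + 1)).rowLen i := rowLen_mono (hS (Nat.le_succ k))
    have htail := tailCard_eq_add (S k)
    have htail' := tailCard_eq_add (S (k + 1))
    -- `τ i` is the number of boxes of the strip in rows below row `i`; the complement `α k - τ i`
    -- plays the role of `b i`.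
    let τ : ℕ → ℕ := fun i => tailCard (S (k + 1)) (i + 1) - tailCard (S k) (i + 1)
    have hτ : ∀ i, τ i = τ (i + 1) + ((S (k + 1)).rowLen (i + 1) - (S k).rowLen (i + 1)) := by
      intro i
      have := hle (i + 1)
      have := hle (i + 1 + 1)
      have := hμν (i + 1)
      have := htail (i + 1)
      have := htail' (i + 1)
      simp only [τ]
      omega
    have hτ_anti : Antitone τ := antitone_nat_of_succ_le fun i => by rw [hτ i]; omega
    have hτ0 : α k = τ 0 + ((S (k + 1)).rowLen 0 - (S k).rowLen 0) := by
      have := hle (0 + 1)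
      have := hμν 0
      have h1 := htail 0
      have h2 := htail' 0
      rw [tailCard_zero, hcard] at h1 h2
      simp only [τ]
      omega
    have hτa : ∀ i, τ i ≤ α k := fun i => by
      have := hτ_anti (Nat.zero_le i)
      omega
    have hcount : Nat.card {y : Fin n → Fin n → K // HasShapesUpTo hα S (k + 1) y} =
        (∏ i ∈ Finset.range L, Nat.card K ^ (α k * (S k).rowLen (i + 1)) *
          Nat.card K ^ (((S k).rowLen i - (S k).rowLen (i + 1)) * τ (i + 1)) *
          rankCount (Nat.card K) ((S k).rowLen i - (S k).rowLen (i + 1)) (α k - τ (i + 1))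
            (τ i - τ (i + 1))) *
        Nat.card {y : Fin n → Fin n → K // HasShapesUpTo hα S k y} := by
      refine natCard_subtype_of_fibers
        (fun (y : Fin n → Fin n → K) (c : Fin n) => if (c : ℕ) < partialSum α k then y c else 0)
        ?_ ?_
      · rintro y ⟨hy0, hy, hrank⟩
        refine ⟨fun c hc => if_neg (not_lt.mpr hc), fun m c hc => ?_, fun m hm i => ?_⟩
        · simp only
          split_ifs
          · exact hy m c hc
          · exact Submodule.zero_mem _
        · rw [← hrank m (hm.trans (Nat.le_succ k)) i]
          rw [map_pow_eq_of_eqOn (linearCombination_eqOn hα fun c hc => (if_pos hc).symm)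
            (map_standardFlag_le hα hy k) ((standardFlag K α hα).mono hm) i]
      · intro y' hy'
        rw [natCard_fiber_hasShapesUpTo hα hS hcard hy']
        refine natCard_extensions _ (map_standardFlag_le hα hy'.2.1 k) ?_
          (finrank_map_inf_ker_of_hasShapesUpTo hα hy') hτ_anti ?_
        · rw [← Submodule.finrank_eq_zero (R := K), hy'.2.2 k le_rfl, htailL k L le_rfl]
        · intro i hi
          simp only [τ, htailL (k + 1) (i + 1) (by omega), Nat.zero_sub]
    have key := prod_qBinomial_mul_shapeFactor hq hQ hq1 (a := α k) (L := L)
      (b := fun i => α k - τ i) hμν (hstrip k) (hL (k + 1))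
      (by omega)
      (fun i => by have := hτ i; have := hτa i; have := hτa (i + 1); omega) (fun i => Nat.sub_le _ _)
      (by simp only [τ, htailL (k + 1) (L + 1) (by omega), Nat.zero_sub, Nat.sub_zero])
    rw [card_eq_sum_rowLen (hL k), hcard, ← hsucc] at key
    have hsub : ∀ i, α k - (α k - τ i) = τ i := fun i => by have := hτa i; omega
    have hsub' : ∀ i, (S (k + 1)).rowLen (i + 1) - (S k).rowLen (i + 1) = τ i - τ (i + 1) :=
      fun i => by have := hτ i; omega
    rw [Finset.prod_range_succ, Finset.prod_range_succ (fun j => qFactorial q (α j)), hcount,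
      Nat.cast_mul, ← mul_assoc]
    simp only [hsub] at key
    simp only [hsub'] at key
    linear_combination (∏ i ∈ Finset.range L,
      qBinomial q ((S (k + 1)).rowLen i - (S (k + 1)).rowLen (i + 1))
        ((S (k + 1)).rowLen i - (S k).rowLen i)) * qFactorial q (α k) * ih +
      (Nat.card {y : Fin n → Fin n → K // HasShapesUpTo hα S k y} : ℝ) * key

end ProductFormula

/-! ### Shapes and weights of a semistandard tableau. -/

section SubShapes

variable {lam : YoungDiagram} (T : SemistandardYoungTableau lam)

theorem mem_subShape {m : ℕ} {c : ℕ × ℕ} : c ∈ subShape T m ↔ c ∈ lam ∧ T c.1 c.2 < m := by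
  rw [← YoungDiagram.mem_cells]
  simp [subShape]

theorem subShape_mono : Monotone (subShape T) := fun m m' h c hc => by
  change c ∈ subShape T m at hc
  rw [mem_subShape] at hc ⊢
  exact ⟨hc.1, hc.2.trans_le h⟩

theorem subShape_le (m : ℕ) : subShape T m ≤ lam := fun _ hc => ((mem_subShape T).mp hc).1

/-- Column strictness: directly above an entry less than `m + 1` stands an entry less than `m`. Thus
consecutive shapes differ by a horizontal strip. -/
theorem rowLen_subShape_succ_le (m i : ℕ) :
    (subShape T (m + 1)).rowLen (i + 1) ≤ (subShape T m).rowLen i := by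
  refine le_of_forall_lt fun j hj => ?_
  rw [← YoungDiagram.mem_iff_lt_rowLen, mem_subShape] at hj ⊢
  have h1 := T.col_strict (Nat.lt_add_one i) hj.1
  have h2 := hj.2
  simp only at h1 h2 ⊢
  exact ⟨lam.up_left_mem (Nat.le_succ i) le_rfl hj.1, by omega⟩

theorem content_apply (l : ℕ) :
    content T l = (lam.cells.filter fun c => T c.1 c.2 = l).card := by
  rw [content, Finsupp.finsetSum_apply, Finset.card_filter]
  exact Finset.sum_congr rfl fun c _ => Finsupp.single_apply

theorem card_subShape (m : ℕ) : (subShape T m).card = partialSum (content T) m := by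
  change (lam.cells.filter fun c => T c.1 c.2 < m).card = _
  induction m with
  | zero => simp [partialSum_zero]
  | succ m ih =>
    rw [partialSum_succ, ← ih, content_apply, ← Finset.card_union_of_disjoint]
    · congr 1
      ext c
      simp only [Finset.mem_filter, Finset.mem_union, ← and_or_left]
      refine and_congr_right fun _ => ?_
      omega
    · rw [Finset.disjoint_filter]
      intro c _ h
      omega

theorem degree_content : (content T).degree = lam.card := by
  rw [content, map_sum]
  simp

theorem subShape_eq_self {k : ℕ} (hk : ∀ i, k ≤ i → content T i = 0) {m : ℕ} (hm : k ≤ m) :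
    subShape T m = lam := by
  have h1 := card_subShape T m
  rw [partialSum_eq_degree _ fun i hi => hk i (hm.trans hi), degree_content] at h1
  apply YoungDiagram.ext
  exact Finset.eq_of_subset_of_card_le (YoungDiagram.cells_subset_iff.mpr (subShape_le T m)) h1.ge

theorem qBinomial_zero_right {q : ℝ} (hq : 0 < q) (m : ℕ) : qBinomial q m 0 = 1 := by
  rw [qBinomial, qFactorial_zero, one_mul, Nat.sub_zero, div_self (qFactorial_pos hq m).ne']

/-- Outside this rectangle the strip has no box in the row, and the factor is a `q`-binomial with
lower entry 0. -/
theorem qWeight_eq_prod {q : ℝ} (hq : 0 < q) {k : ℕ} (hk : ∀ i, k ≤ i → content T i = 0) :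
    qWeight q T = ∏ j ∈ Finset.range k, ∏ i ∈ Finset.range (lam.colLen 0),
      qBinomial q ((subShape T (j + 1)).rowLen i - (subShape T (j + 1)).rowLen (i + 1))
        ((subShape T (j + 1)).rowLen i - (subShape T j).rowLen i) := by
  rw [qWeight, finprod_eq_prod_of_mulSupport_subset (s := Finset.range (lam.colLen 0) ×ˢ
    Finset.range k), Finset.prod_product_right]
  rintro ⟨i, j⟩ hij
  by_contra hcon
  refine hij ?_
  simp only
  have h0 : (subShape T (j + 1)).rowLen i - (subShape T j).rowLen i = 0 := by
    rw [Finset.coe_product, Set.mem_prod, Finset.coe_range, Finset.coe_range, Set.mem_Iio,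
      Set.mem_Iio, not_and_or, not_lt, not_lt] at hcon
    rcases hcon with h | h
    · have h1 := rowLen_mono (subShape_le T (j + 1)) i
      rw [rowLen_eq_zero h] at h1
      omega
    · rw [subShape_eq_self T hk h, subShape_eq_self T hk (Nat.le_succ_of_le h), Nat.sub_self]
  rw [h0, qBinomial_zero_right hq]

end SubShapes

/-! ### The formula for a fixed tableau. -/

section FixedTableau

variable {K : Type*} [Field K] {n : ℕ} {α : ℕ →₀ ℕ} (hα : α.degree = n)

theorem hasTableauJF_iff {lam : YoungDiagram} (T : SemistandardYoungTableau lam)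
    (f : (Fin n → K) →ₗ[K] (Fin n → K)) :
    HasTableauJF f (standardFlag K α hα) T ↔ StrictlyCompatible (standardFlag K α hα) f ∧
      ∀ m i, finrank K (((standardFlag K α hα).space m).map (f ^ i)) =
        tailCard (subShape T m) i := by
  constructor
  · rintro ⟨h, hT⟩
    exact ⟨h, fun m => (hasJF_restrict_iff _ _ _ _).mp (hT m)⟩
  · rintro ⟨h, hT⟩
    exact ⟨h, fun m => (hasJF_restrict_iff _ _ _ _).mpr (hT m)⟩

theorem content_eq_of_hasTableauJF {lam : YoungDiagram} {T : SemistandardYoungTableau lam}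
    {f : (Fin n → K) →ₗ[K] (Fin n → K)} (h : HasTableauJF f (standardFlag K α hα) T) :
    content T = α := by
  have h1 : ∀ m, partialSum (content T) m = partialSum α m := fun m => by
    rw [← card_subShape, ← tailCard_zero, ← ((hasTableauJF_iff hα T f).mp h).2 m 0, pow_zero,
      Module.End.one_eq_id, Submodule.map_id, (standardFlag K α hα).finrank_eq]
  ext m
  have h2 := h1 (m + 1)
  rw [partialSum_succ, partialSum_succ, h1 m] at h2
  omega

/-- From index `k` on, both the flag and the shapes are constant, so finitely many conditions
suffice. -/
theorem natCard_hasTableauJF {lam : YoungDiagram} {T : SemistandardYoungTableau lam}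
    (hT : content T = α) {k : ℕ} (hk : ∀ i, k ≤ i → α i = 0) :
    Nat.card {N : Matrix (Fin n) (Fin n) K // N ∈ nilradical K n α ∧
      HasTableauJF (Matrix.toLin' N) (standardFlag K α hα) T} =
    Nat.card {y : Fin n → Fin n → K // HasShapesUpTo hα (subShape T) k y} := by
  have hpk : ∀ m, k ≤ m → partialSum α m = n := fun m hm =>
    (partialSum_eq_degree α fun i hi => hk i (hm.trans hi)).trans hα
  have hspace : ∀ m, k ≤ m → (standardFlag K α hα).space m = (standardFlag K α hα).space k := by
    intro m hm
    refine (Submodule.eq_of_le_of_finrank_eq ((standardFlag K α hα).mono hm) ?_).symm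
    rw [(standardFlag K α hα).finrank_eq, (standardFlag K α hα).finrank_eq, hpk m hm, hpk k le_rfl]
  have hshape : ∀ m, k ≤ m → subShape T m = subShape T k := fun m hm => by
    rw [subShape_eq_self T (hT ▸ hk) hm, subShape_eq_self T (hT ▸ hk) le_rfl]
  refine Nat.card_congr (Equiv.subtypeEquiv
    { toFun := fun N c r => N r c
      invFun := fun y r c => y c r
      left_inv := fun _ => rfl
      right_inv := fun _ => rfl } fun N => ?_)
  rw [mem_nilradical_iff hα, hasTableauJF_iff, toLin'_eq_linearCombination,
    strictlyCompatible_linearCombination_iff]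
  change _ ↔ HasShapesUpTo hα (subShape T) k fun c r => N r c
  constructor
  · rintro ⟨h1, _, h2⟩
    refine ⟨fun c hc => ?_, h1, fun m _ => h2 m⟩
    have := hpk k le_rfl
    omega
  · rintro ⟨_, h1, h2⟩
    refine ⟨h1, h1, fun m => ?_⟩
    rcases Nat.lt_or_ge k m with h | h
    · rw [hspace m h.le, hshape m h.le]
      exact h2 k le_rfl
    · exact h2 m h

theorem qWeight_eq_natCard [Finite K] {q : ℝ} (hq : q * (Nat.card K : ℝ) = 1) (hq0 : 0 < q)
    (hq1 : q < 1) {lam : YoungDiagram} {T : SemistandardYoungTableau lam}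
    (hT : content T = α) :
    qWeight q T =
      q ^ ((n.choose 2 : ℤ) - (nCon lam : ℤ)) * (1 - q) ^ (-(n : ℤ) + (lam.rowLen 0 : ℤ)) *
        (∏ i ∈ Finset.range (lam.colLen 0), qFactorial q (lam.rowLen i - lam.rowLen (i + 1))) /
        (∏ i ∈ α.support, qFactorial q (α i)) *
      (Nat.card {N : Matrix (Fin n) (Fin n) K // N ∈ nilradical K n α ∧
        HasTableauJF (Matrix.toLin' N) (standardFlag K α hα) T} : ℝ) := by
  obtain ⟨k, hk⟩ := exists_forall_ge_eq_zero α
  have hsub : α.support ⊆ Finset.range k := fun i hi => by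
    rw [Finset.mem_range]
    by_contra h
    exact Finsupp.mem_support_iff.mp hi (hk i (not_lt.mp h))
  have hprod : ∏ i ∈ α.support, qFactorial q (α i) = ∏ i ∈ Finset.range k, qFactorial q (α i) :=
    Finset.prod_subset hsub fun i _ hi => by
      rw [Finsupp.notMem_support_iff.mp hi, qFactorial_zero]
  have hne : ∏ i ∈ Finset.range k, qFactorial q (α i) ≠ 0 :=
    (Finset.prod_pos fun i _ => qFactorial_pos hq0 _).ne'
  have key := prod_qBinomial_eq_natCard_hasShapesUpTo (K := K) hα hq hq1 (subShape_mono T)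
    (rowLen_subShape_succ_le T) (fun m => by rw [card_subShape, hT]) (L := lam.colLen 0)
    (fun m => Nat.le_zero.mp ((rowLen_mono (subShape_le T m) _).trans_eq (rowLen_eq_zero le_rfl))) k
  rw [← qWeight_eq_prod T hq0 (hT ▸ hk), partialSum_eq_degree α hk, hα,
    subShape_eq_self T (hT ▸ hk) le_rfl, ← natCard_hasTableauJF hα hT hk] at key
  rw [hprod, div_mul_eq_mul_div, eq_div_iff hne, key]
  rfl

end FixedTableau

end QWhittaker

namespace QWhittaker

open Module

/-! ### Tableaux as chains of shapes. -/

section TableauOfShapes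

theorem tableau_eq_of_subShape_eq {lam : YoungDiagram} {T T' : SemistandardYoungTableau lam}
    (h : ∀ m, subShape T m = subShape T' m) : T = T' := by
  refine SemistandardYoungTableau.ext fun i j => ?_
  by_cases hij : (i, j) ∈ lam
  · refine eq_of_forall_gt_iff fun m => ?_
    have h1 : (i, j) ∈ subShape T m ↔ (i, j) ∈ subShape T' m := by rw [h m]
    rw [mem_subShape, mem_subShape] at h1
    simpa [hij] using h1
  · rw [T.zeros hij, T'.zeros hij]

/-- The semistandard tableau recording a family of shapes `g 0 ⊆ g 1 ⊆ ⋯`, given by their row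
lengths, any two consecutive ones of which differ by a horizontal strip. -/
noncomputable def tableauOfRowLens (lam : YoungDiagram) (g : ℕ → ℕ → ℕ) (h0 : ∀ i, g 0 i = 0)
    (hanti : ∀ m, Antitone (g m)) (hstrip : ∀ m i, g (m + 1) (i + 1) ≤ g m i)
    (hlam : ∀ i j, (i, j) ∈ lam ↔ ∃ m, j < g m i) : SemistandardYoungTableau lam :=
  have hex : ∀ i j, (i, j) ∈ lam → j < g (sInf {m | j < g (m + 1) i} + 1) i := fun i j h => by
    obtain ⟨m, hm⟩ := (hlam i j).mp h
    have hne : {m | j < g (m + 1) i}.Nonempty := by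
      cases m with
      | zero => rw [h0] at hm; exact absurd hm (Nat.not_lt_zero _)
      | succ m => exact ⟨m, hm⟩
    exact Nat.sInf_mem hne
  -- Letters are numbered from 0, so letter `m` labels the boxes that first appear in shape `m + 1`.
  -- Off the diagram the set is empty, and its infimum 0 is the required default entry.
  { entry := fun i j => sInf {m | j < g (m + 1) i}
    row_weak' := fun {i j1 j2} hj h => Nat.sInf_le (hj.trans (hex i j2 h))
    col_strict' := fun {i1 i2 j} hi h => by
      have h1 := hex i2 j h
      obtain ⟨i, rfl⟩ := Nat.exists_eq_succ_of_ne_zero (Nat.ne_zero_of_lt hi)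
      generalize sInf {m | j < g (m + 1) (i + 1)} = m at h1 ⊢
      have h2 : j < g m i1 := (h1.trans_le (hstrip m i)).trans_le (hanti m (by omega))
      cases m with
      | zero => rw [h0] at h2; exact absurd h2 (Nat.not_lt_zero _)
      | succ m => exact Nat.lt_succ_of_le (Nat.sInf_le h2)
    zeros' := fun {i j} h => by
      rw [Nat.sInf_eq_zero]
      right
      rw [Set.eq_empty_iff_forall_notMem]
      exact fun m hm => h ((hlam i j).mpr ⟨m + 1, hm⟩) }

theorem rowLen_subShape_tableauOfRowLens {lam : YoungDiagram} {g : ℕ → ℕ → ℕ}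
    (h0 : ∀ i, g 0 i = 0) (hanti : ∀ m, Antitone (g m))
    (hstrip : ∀ m i, g (m + 1) (i + 1) ≤ g m i) (hlam : ∀ i j, (i, j) ∈ lam ↔ ∃ m, j < g m i)
    (hmono : ∀ i, Monotone fun m => g m i) (m i : ℕ) :
    (subShape (tableauOfRowLens lam g h0 hanti hstrip hlam) m).rowLen i = g m i := by
  refine eq_of_forall_lt_iff fun j => ?_
  rw [← YoungDiagram.mem_iff_lt_rowLen, mem_subShape]
  change (i, j) ∈ lam ∧ sInf {m | j < g (m + 1) i} < m ↔ _
  constructor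
  · rintro ⟨h, hm⟩
    obtain ⟨m', hm'⟩ := (hlam i j).mp h
    have hne : {m | j < g (m + 1) i}.Nonempty := by
      cases m' with
      | zero => rw [h0] at hm'; exact absurd hm' (Nat.not_lt_zero _)
      | succ m' => exact ⟨m', hm'⟩
    exact (Nat.sInf_mem hne : j < g (_ + 1) i).trans_le (hmono i hm)
  · intro hj
    refine ⟨(hlam i j).mpr ⟨m, hj⟩, ?_⟩
    cases m with
    | zero => rw [h0] at hj; exact absurd hj (Nat.not_lt_zero _)
    | succ m => exact Nat.lt_succ_of_le (Nat.sInf_le hj)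

end TableauOfShapes

/-! ### The tableau of an endomorphism: existence and uniqueness. -/

section TableauOfEndomorphism

variable {K : Type*} [Field K] {n : ℕ} {α : ℕ →₀ ℕ} (hα : α.degree = n)

theorem hasTableauJF_unique {lam : YoungDiagram} {T T' : SemistandardYoungTableau lam}
    {f : (Fin n → K) →ₗ[K] (Fin n → K)} (h : HasTableauJF f (standardFlag K α hα) T)
    (h' : HasTableauJF f (standardFlag K α hα) T') : T = T' := by
  rw [hasTableauJF_iff] at h h'
  exact tableau_eq_of_subShape_eq fun m => tailCard_injective <| funext fun i =>
    (h.2 m i).symm.trans (h'.2 m i)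

theorem exists_standardFlag_eq_top : ∃ k, (standardFlag K α hα).space k = ⊤ := by
  obtain ⟨k, hk⟩ := exists_forall_ge_eq_zero α
  refine ⟨k, Submodule.eq_top_of_finrank_eq ?_⟩
  rw [(standardFlag K α hα).finrank_eq, partialSum_eq_degree α hk, hα, finrank_fin_fun]

theorem hasJF_of_hasTableauJF {lam : YoungDiagram} (hlam : lam.card = n)
    {T : SemistandardYoungTableau lam} {f : (Fin n → K) →ₗ[K] (Fin n → K)}
    (h : HasTableauJF f (standardFlag K α hα) T) : HasJF f lam := by
  obtain ⟨k, hk⟩ := exists_standardFlag_eq_top (K := K) hα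
  have h1 := ((hasTableauJF_iff hα T f).mp h).2 k
  have hshape : subShape T k = lam := by
    apply YoungDiagram.ext
    refine Finset.eq_of_subset_of_card_le (YoungDiagram.cells_subset_iff.mpr (subShape_le T k)) ?_
    have h2 := h1 0
    rw [hk, pow_zero, Module.End.one_eq_id, Submodule.map_id, finrank_top, finrank_fin_fun,
      tailCard_zero] at h2
    exact (hlam.trans h2).le
  rw [hasJF_iff_finrank_range_pow]
  intro i
  rw [LinearMap.range_eq_map, ← hk, h1, hshape]

/-- The row lengths of the shapes are forced: `g m i = dim (f^i E_m ∩ ker f)`. From `f E_m ⊆ E_m`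
they decrease in `i`, and from `f E_{m+1} ⊆ E_m` one gets `f^(i+1) E_{m+1} ⊆ f^i E_m`, which is the
horizontal strip condition. -/
theorem exists_hasTableauJF {lam : YoungDiagram} {f : (Fin n → K) →ₗ[K] (Fin n → K)}
    (hf : StrictlyCompatible (standardFlag K α hα) f) (hJF : HasJF f lam) :
    ∃ T : SemistandardYoungTableau lam, HasTableauJF f (standardFlag K α hα) T := by
  obtain ⟨k, hk⟩ := exists_standardFlag_eq_top (K := K) hα
  set E := (standardFlag K α hα).space with hE
  let g : ℕ → ℕ → ℕ := fun m i => finrank K ((E m).map (f ^ i) ⊓ LinearMap.ker f :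
    Submodule K (Fin n → K))
  have hrank : ∀ m i, finrank K ((E m).map (f ^ i)) =
      g m i + finrank K ((E m).map (f ^ (i + 1))) := fun m i => by
    rw [← finrank_map_add_finrank_inf_ker f ((E m).map (f ^ i)), ← Submodule.map_comp,
      ← Module.End.mul_eq_comp, ← pow_succ', add_comm]
  have hmono : ∀ i, Monotone fun m => g m i := fun i m m' h =>
    Submodule.finrank_mono (inf_le_inf_right _ (Submodule.map_mono ((standardFlag K α hα).mono h)))
  have hmap : ∀ m m' i, (E m).map f ≤ E m' → g m (i + 1) ≤ g m' i := fun m m' i h => by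
    refine Submodule.finrank_mono (inf_le_inf_right _ ?_)
    rw [pow_succ, Module.End.mul_eq_comp, Submodule.map_comp]
    exact Submodule.map_mono h
  have h0 : ∀ i, g 0 i = 0 := fun i => by
    have hE0 : E 0 = ⊥ := by
      rw [← Submodule.finrank_eq_zero (R := K), hE, (standardFlag K α hα).finrank_eq,
        partialSum_zero]
    simp only [g]
    rw [Submodule.finrank_eq_zero, hE0, Submodule.map_bot, bot_inf_eq]
  have hanti : ∀ m, Antitone (g m) := fun m => antitone_nat_of_succ_le fun i =>
    hmap m m i (Submodule.map_le_iff_le_comap.mpr (hf.mapsTo m))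
  have hstrip : ∀ m i, g (m + 1) (i + 1) ≤ g m i := fun m i => hmap _ _ i (hf m)
  have htop : ∀ i, finrank K ((E k).map (f ^ i)) = tailCard lam i := fun i => by
    rw [hk, ← LinearMap.range_eq_map, hJF.finrank_range_pow]
  have hgk : ∀ i, g k i = lam.rowLen i := fun i => by
    have h1 := hrank k i
    rw [htop, htop, tailCard_eq_add] at h1
    omega
  have hle : ∀ m, E m ≤ E k := fun m => by rw [hk]; exact le_top
  have hlam : ∀ i j, (i, j) ∈ lam ↔ ∃ m, j < g m i := fun i j => by
    rw [YoungDiagram.mem_iff_lt_rowLen, ← hgk]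
    exact ⟨fun h => ⟨k, h⟩, fun ⟨m, h⟩ => h.trans_le
      (Submodule.finrank_mono (inf_le_inf_right _ (Submodule.map_mono (hle m))))⟩
  refine ⟨tableauOfRowLens lam g h0 hanti hstrip hlam, (hasTableauJF_iff hα _ f).mpr ⟨hf, ?_⟩⟩
  intro m
  have hrow := rowLen_subShape_tableauOfRowLens h0 hanti hstrip hlam hmono m
  -- Ranks are recovered by summing the `g m i` downwards from an index at which both sides vanish.
  have key : ∀ d i, lam.colLen 0 ≤ i + d → finrank K ((E m).map (f ^ i)) =
      tailCard (subShape (tableauOfRowLens lam g h0 hanti hstrip hlam) m) i := by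
    intro d
    induction d with
    | zero =>
      intro i hi
      have h1 : finrank K ((E m).map (f ^ i)) ≤ finrank K ((E k).map (f ^ i)) :=
        Submodule.finrank_mono (Submodule.map_mono (hle m))
      have h2 := tailCard_mono (subShape_le (tableauOfRowLens lam g h0 hanti hstrip hlam) m) i
      rw [htop] at h1
      rw [tailCard_eq_zero (mu := lam) (by omega)] at h1 h2
      omega
    | succ d ih =>
      intro i hi
      rw [hrank, tailCard_eq_add, hrow, ih (i + 1) (by omega)]
  exact fun i => key (lam.colLen 0) i (by omega)

end TableauOfEndomorphism

/-! ### The coefficient as a sum over tableaux. -/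

section Coefficient

theorem finite_content_eq (lam : YoungDiagram) (α : ℕ →₀ ℕ) :
    Finite {T : SemistandardYoungTableau lam // content T = α} := by
  obtain ⟨k, hk⟩ := exists_forall_ge_eq_zero α
  have hlt : ∀ (T : {T : SemistandardYoungTableau lam // content T = α}) (c : lam.cells),
      T.1 c.1.1 c.1.2 < k := by
    rintro ⟨T, rfl⟩ ⟨c, hc⟩
    by_contra hcon
    have h := hk _ (not_lt.mp hcon)
    rw [content_apply, Finset.card_eq_zero, Finset.filter_eq_empty_iff] at h
    exact h hc rfl
  refine Finite.of_injective (β := lam.cells → Fin k) (fun T c => ⟨_, hlt T c⟩) fun T T' h => ?_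
  refine Subtype.ext (SemistandardYoungTableau.ext fun i j => ?_)
  by_cases hij : (i, j) ∈ lam
  · exact congrArg Fin.val (congrFun h ⟨(i, j), hij⟩)
  · rw [T.1.zeros hij, T'.1.zeros hij]

theorem coeff_whittaker {F : Type*} [Field F] (q : F) (lam : YoungDiagram) (α : ℕ →₀ ℕ)
    [Fintype {T : SemistandardYoungTableau lam // content T = α}] :
    MvPowerSeries.coeff α (whittaker q lam) =
      ∑ T : {T : SemistandardYoungTableau lam // content T = α}, qWeight q T.1 := by
  classical
  rw [← finsum_eq_sum_of_fintype, finsum_subtype_eq_finsum_cond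
    (f := fun T : SemistandardYoungTableau lam => qWeight q T) (fun T => content T = α)]
  change ∑ᶠ T : SemistandardYoungTableau lam, _ = _
  refine finsum_congr fun T => ?_
  rw [MvPowerSeries.coeff_monomial, finsum_eq_if]
  simp only [eq_comm]

variable {K : Type*} [Field K] [Finite K] {n : ℕ} {α : ℕ →₀ ℕ} (hα : α.degree = n)

/-- The matrices are sorted by their tableau, which exists, is unique, and automatically has content
`α`. -/
theorem natCard_hasJF_eq_sum {lam : YoungDiagram} (hlam : lam.card = n)
    [Fintype {T : SemistandardYoungTableau lam // content T = α}] :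
    Nat.card {N : Matrix (Fin n) (Fin n) K // N ∈ nilradical K n α ∧
      HasJF (Matrix.toLin' N) lam} =
    ∑ T : {T : SemistandardYoungTableau lam // content T = α},
      Nat.card {N : Matrix (Fin n) (Fin n) K // N ∈ nilradical K n α ∧
        HasTableauJF (Matrix.toLin' N) (standardFlag K α hα) T.1} := by
  rw [← Nat.card_sigma]
  symm
  refine Nat.card_eq_of_bijective
    (fun s => ⟨s.2.1, s.2.2.1, hasJF_of_hasTableauJF hα hlam s.2.2.2⟩) ⟨?_, ?_⟩
  · rintro ⟨T, N, hN⟩ ⟨T', N', hN'⟩ h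
    obtain rfl : N = N' := congrArg Subtype.val h
    obtain rfl : T = T' := Subtype.ext (hasTableauJF_unique hα hN.2 hN'.2)
    rfl
  · rintro ⟨N, hN, hJF⟩
    obtain ⟨T, hT⟩ := exists_hasTableauJF hα ((mem_nilradical_iff hα N).mp hN) hJF
    exact ⟨⟨⟨T, content_eq_of_hasTableauJF hα hT⟩, N, hN, hT⟩, rfl⟩

end Coefficient

end QWhittaker

theorem theorem4p10 (K : Type*) [Field K] [Finite K] (q : ℝ) (hq : 1 / q = (Nat.card K : ℝ))
    (n : ℕ) (lam : YoungDiagram) (hlam : lam.card = n)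
    (α : ℕ →₀ ℕ) (hα : α.degree = n) :
    (∀ T : SemistandardYoungTableau lam, QWhittaker.content T = α →
      QWhittaker.qWeight q T =
        q ^ ((n.choose 2 : ℤ) - (QWhittaker.nCon lam : ℤ)) *
            (1 - q) ^ (-(n : ℤ) + (lam.rowLen 0 : ℤ)) *
            (∏ i ∈ Finset.range (lam.colLen 0),
              QWhittaker.qFactorial q (lam.rowLen i - lam.rowLen (i + 1))) /
          (∏ i ∈ α.support, QWhittaker.qFactorial q (α i)) *
        (Nat.card {N : Matrix (Fin n) (Fin n) K //
          N ∈ QWhittaker.nilradical K n α ∧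
            QWhittaker.HasTableauJF (Matrix.toLin' N) (QWhittaker.standardFlag K α hα) T} : ℝ)) ∧
    MvPowerSeries.coeff α (QWhittaker.whittaker q lam) =
        q ^ ((n.choose 2 : ℤ) - (QWhittaker.nCon lam : ℤ)) *
            (1 - q) ^ (-(n : ℤ) + (lam.rowLen 0 : ℤ)) *
            (∏ i ∈ Finset.range (lam.colLen 0),
              QWhittaker.qFactorial q (lam.rowLen i - lam.rowLen (i + 1))) /
          (∏ i ∈ α.support, QWhittaker.qFactorial q (α i)) *
        (Nat.card {N : Matrix (Fin n) (Fin n) K //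
          N ∈ QWhittaker.nilradical K n α ∧ QWhittaker.HasJF (Matrix.toLin' N) lam} : ℝ) := by
  have hcard : (1 : ℝ) < (Nat.card K : ℝ) := by exact_mod_cast Finite.one_lt_card
  -- Since `1 / 0 = 0`, the value `q = 0` would give `|K| = 0`.
  have hqne : q ≠ 0 := by
    rintro rfl
    rw [div_zero] at hq
    linarith
  have hq1 : q * (Nat.card K : ℝ) = 1 := by rw [← hq, mul_one_div_cancel hqne]
  have hpos : 0 < q := by
    rw [← one_div_pos, hq]
    linarith
  have hlt : q < 1 := by nlinarith
  have hT : ∀ T : SemistandardYoungTableau lam, QWhittaker.content T = α → _ := fun T hT =>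
    QWhittaker.qWeight_eq_natCard (K := K) hα hq1 hpos hlt hT
  refine ⟨hT, ?_⟩
  have := QWhittaker.finite_content_eq lam α
  have := Fintype.ofFinite {T : SemistandardYoungTableau lam // QWhittaker.content T = α}
  rw [QWhittaker.coeff_whittaker, QWhittaker.natCard_hasJF_eq_sum hα hlam, Nat.cast_sum,
    Finset.mul_sum]
  exact Finset.sum_congr rfl fun T _ => hT T.1 T.2
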